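/- For real order $\nu\ge 0$ let $J_\nu$ and $Y_\nu$ denote the Bessel functions of the first and second kinds on $(0,\infty)$. Fix $b>1$ and put $$U_\nu(\rho,t)=J_\nu(\rho t)\,Y_\nu(\rho b)-J_\nu(\rho b)\,Y_\nu(\rho t)\qquad(\rho>0,\ t>0),$$ $$\psi_\nu(t)=t^{\nu}-t^{-\nu}\qquad(\nu>0,\ t>0).$$ For every $\nu\ge 0$ the positive zeros of $\rho\mapsto U_\nu(\rho,1)$ form an infinite sequence $\rho_{\nu,1}<\rho_{\nu,2}<\cdots$ (in which every positive zero occurs), and the following holds for every $s$ with $1<s<b$. (a) If $\nu>0$, then $$2\nu\sum_{m=1}^{\infty}\frac{U_\nu(\rho_{\nu,m},s)\,U_\nu(\rho_{\nu,m},t)}{\rho_{\nu,m}^{2}\int_1^b\{U_\nu(\rho_{\nu,m},\tau)\}^2\,\tau\,d\tau}=\begin{cases}\dfrac{\psi_\nu(t)\,\psi_\nu(b/s)}{\psi_\nu(b)}&(1\le t\le s),\\[2ex]\dfrac{\psi_\nu(s)\,\psi_\nu(b/t)}{\psi_\nu(b)}&(s<t\le b),\end{cases}$$ and the series converges uniformly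 for $t\in[1,b]$. (b) In the case $\nu=0$, $$\sum_{m=1}^{\infty}\frac{U_0(\rho_{0,m},s)\,U_0(\rho_{0,m},t)}{\rho_{0,m}^{2}\int_1^b\{U_0(\rho_{0,m},\tau)\}^2\,\tau\,d\tau}=\begin{cases}\dfrac{(\log t)\,\log(b/s)}{\log b}&(1\le t\le s),\\[2ex]\dfrac{(\log s)\,\log(b/t)}{\log b}&(s<t\le b),\end{cases}$$ and the series converges uniformly for $t\in[1,b]$. -/

import Mathlib

/-- The Bessel function of the first kind `J_ν(x)` of real order `ν`, for `x > 0`, by its power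
series. At the poles of `Γ`, `Real.Gamma` is `0`, so the corresponding terms vanish, as in the usual
convention `1 / Γ(-n) = 0`. -/
noncomputable def besselJ (ν x : ℝ) : ℝ :=
  ∑' k : ℕ, (-1 : ℝ) ^ k / ((k.factorial : ℝ) * Real.Gamma (ν + k + 1)) * (x / 2) ^ (2 * (k : ℝ) + ν)

/-- The quotient `(J_ν(x) cos νπ - J_{-ν}(x)) / sin νπ`, meaningful for `ν` not an integer. -/
noncomputable def besselYQuotient (ν x : ℝ) : ℝ :=
  (besselJ ν x * Real.cos (ν * Real.pi) - besselJ (-ν) x) / Real.sin (ν * Real.pi)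

open Classical in
/-- The Bessel function of the second kind `Y_ν(x)` of real order `ν`, for `x > 0`: the quotient
above if `ν` is not an integer, and its limit as the order tends to `ν` if `ν` is an integer. -/
noncomputable def besselY (ν x : ℝ) : ℝ :=
  if ∃ n : ℤ, (n : ℝ) = ν then
    Filter.limUnder (nhdsWithin ν {ν}ᶜ) (fun μ : ℝ => besselYQuotient μ x)
  else besselYQuotient ν x

/-- The cross product `U_ν(ρ, t) = J_ν(ρ t) Y_ν(ρ b) - J_ν(ρ b) Y_ν(ρ t)`. -/
noncomputable def crossU (b ν ρ t : ℝ) : ℝ :=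
  besselJ ν (ρ * t) * besselY ν (ρ * b) - besselJ ν (ρ * b) * besselY ν (ρ * t)

/-- For `m ≥ 1`, the `m`-th positive zero `ρ_{ν,m}` of `ρ ↦ U_ν(ρ, 1)`, in increasing order: each
is the least zero beyond the previous one. The recursion starts from the auxiliary value `0` at
`m = 0`, which does not belong to the sequence. -/
noncomputable def crossZero (b ν : ℝ) : ℕ → ℝ
  | 0 => 0
  | m + 1 => sInf {ρ : ℝ | crossZero b ν m < ρ ∧ crossU b ν ρ 1 = 0}

/-- The `m`-th term
`U_ν(ρ_{ν,m}, s) U_ν(ρ_{ν,m}, t) / (ρ_{ν,m}² ∫_1^b U_ν(ρ_{ν,m}, τ)² τ dτ)`. -/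
noncomputable def crossTerm (b ν s t : ℝ) (m : ℕ) : ℝ :=
  crossU b ν (crossZero b ν m) s * crossU b ν (crossZero b ν m) t /
    (crossZero b ν m ^ 2 * ∫ τ in (1 : ℝ)..b, crossU b ν (crossZero b ν m) τ ^ 2 * τ)

/-- `ψ_ν(t) = t^ν - t^{-ν}`. -/
noncomputable def psiFun (ν t : ℝ) : ℝ := t ^ ν - t ^ (-ν)

/-!
In the variable `z` with `t = b e^{-z}`, Bessel's equation becomes `y'' = (ν² - ρ² w) y` with
weight `w = (b e^{-z})²`, and `z ↦ U_ν(ρ, b e^{-z})` is the solution with `y(0) = 0` and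
`y'(0) = 2 / π`; for integer `ν`, where `Y_ν` is a limit in the order, this is inherited from the
neighbouring orders. The zeros of `U_ν(·, 1)` are thus the square roots of the eigenvalues of
`-y'' + ν² y = λ w y` on `[0, log b]` with Dirichlet conditions.

The Green function of `-y'' + ν² y` is, like the covariance of Brownian motion, the Gram matrix of a
continuous curve `e` in `L²(ℝ)`. By the spectral theorem for the compact operator `∫ w e ⊗ e`, each
`e(s)` is a sum of orthogonal eigenvectors, one for each zero. Pairing this sum with the bounded
curve `e(t)` gives an expansion of the Green function that converges uniformly in `t`, and the Green
function is explicit: a product of hyperbolic sines for `ν ≠ 0`, piecewise linear for `ν = 0`. The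
trace of the operator is finite, so the zeros are locally finite; the Green function is not
differentiable on the diagonal, so there are infinitely many.
-/

open Filter Topology Set
open scoped RealInnerProductSpace

/-! ### The linear equation `y'' = q y` -/

/-- `y` solves the differential equation `y'' = q y` on the real line. -/
structure IsSolution (q y : ℝ → ℝ) : Prop where
  differentiable : Differentiable ℝ y
  hasDerivAt_deriv : ∀ z, HasDerivAt (deriv y) (q z * y z) z

namespace IsSolution

variable {q q₁ q₂ y y₁ y₂ : ℝ → ℝ}

theorem of_hasDerivAt {y' : ℝ → ℝ} (h : ∀ z, HasDerivAt y (y' z) z)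
    (h' : ∀ z, HasDerivAt y' (q z * y z) z) : IsSolution q y where
  differentiable z := (h z).differentiableAt
  hasDerivAt_deriv := by rwa [show deriv y = y' from funext fun z => (h z).deriv]

theorem hasDerivAt (h : IsSolution q y) (z : ℝ) : HasDerivAt y (deriv y z) z :=
  (h.differentiable z).hasDerivAt

theorem continuous (h : IsSolution q y) : Continuous y :=
  h.differentiable.continuous

theorem continuous_deriv (h : IsSolution q y) : Continuous (deriv y) :=
  continuous_iff_continuousAt.2 fun z => (h.hasDerivAt_deriv z).continuousAt

theorem comp_neg (h : IsSolution q y) : IsSolution (fun z => q (-z)) fun z => y (-z) :=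
  .of_hasDerivAt (y' := fun z => -deriv y (-z))
    (fun z => ((h.hasDerivAt (-z)).comp z (hasDerivAt_neg z)).congr_deriv (by ring))
    fun z => ((h.hasDerivAt_deriv (-z)).comp z (hasDerivAt_neg z)).neg.congr_deriv (by ring)

theorem const_mul (h : IsSolution q y) (c : ℝ) : IsSolution q fun z => c * y z :=
  .of_hasDerivAt (fun z => (h.hasDerivAt z).const_mul c) fun z =>
    ((h.hasDerivAt_deriv z).const_mul c).congr_deriv (by ring)

theorem sub (h₁ : IsSolution q y₁) (h₂ : IsSolution q y₂) : IsSolution q fun z => y₁ z - y₂ z :=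
  .of_hasDerivAt (fun z => (h₁.hasDerivAt z).sub (h₂.hasDerivAt z)) fun z =>
    ((h₁.hasDerivAt_deriv z).sub (h₂.hasDerivAt_deriv z)).congr_deriv (by ring)

theorem hasDerivAt_wronskian (h₁ : IsSolution q₁ y₁) (h₂ : IsSolution q₂ y₂) (z : ℝ) :
    HasDerivAt (fun z => deriv y₁ z * y₂ z - y₁ z * deriv y₂ z)
      ((q₁ z - q₂ z) * y₁ z * y₂ z) z :=
  (((h₁.hasDerivAt_deriv z).mul (h₂.hasDerivAt z)).sub
    ((h₁.hasDerivAt z).mul (h₂.hasDerivAt_deriv z))).congr_deriv (by ring)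

theorem wronskian_eq (h₁ : IsSolution q y₁) (h₂ : IsSolution q y₂) (z : ℝ) :
    deriv y₁ z * y₂ z - y₁ z * deriv y₂ z = deriv y₁ 0 * y₂ 0 - y₁ 0 * deriv y₂ 0 :=
  is_const_of_deriv_eq_zero (fun z => (h₁.hasDerivAt_wronskian h₂ z).differentiableAt)
    (fun z => by simp [(h₁.hasDerivAt_wronskian h₂ z).deriv]) z 0

end IsSolution

theorem norm_pair_le_of_hasDerivAt {q y y' : ℝ → ℝ} {K M : ℝ}
    (hy : ∀ z ∈ Icc 0 M, HasDerivAt y (y' z) z)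
    (hy' : ∀ z ∈ Icc 0 M, HasDerivAt y' (q z * y z) z) (hK : 1 ≤ K)
    (hq : ∀ z ∈ Icc 0 M, |q z| ≤ K) {z : ℝ} (hz : z ∈ Icc 0 M) :
    ‖(y z, y' z)‖ ≤ ‖(y 0, y' 0)‖ * Real.exp (K * z) := by
  have hderiv z (hz : z ∈ Icc 0 M) : HasDerivAt (fun z => (y z, y' z)) (y' z, q z * y z) z :=
    (hy z hz).prodMk (hy' z hz)
  have hbound z (hz : z ∈ Ico 0 M) : ‖(y' z, q z * y z)‖ ≤ K * ‖(y z, y' z)‖ + 0 := by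
    rw [add_zero, norm_prod_le_iff]
    constructor
    · exact (norm_snd_le (y z, y' z)).trans (le_mul_of_one_le_left (norm_nonneg _) hK)
    · rw [norm_mul]
      exact mul_le_mul (hq z (Ico_subset_Icc_self hz)) (norm_fst_le (y z, y' z)) (norm_nonneg _)
        (zero_le_one.trans hK)
  simpa [gronwallBound_ε0] using norm_le_gronwallBound_of_norm_deriv_right_le
    (fun z hz => (hderiv z hz).continuousAt.continuousWithinAt)
    (fun z hz => (hderiv z (Ico_subset_Icc_self hz)).hasDerivWithinAt) le_rfl hbound z hz

theorem eq_zero_of_hasDerivAt {q y y' : ℝ → ℝ} {M : ℝ} (hq : Continuous q)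
    (hy : ∀ z ∈ Icc 0 M, HasDerivAt y (y' z) z)
    (hy' : ∀ z ∈ Icc 0 M, HasDerivAt y' (q z * y z) z) (h0 : y 0 = 0) (h0' : y' 0 = 0)
    {z : ℝ} (hz : z ∈ Icc 0 M) : y z = 0 := by
  obtain ⟨K, hK⟩ := (isCompact_Icc (a := 0) (b := M)).exists_bound_of_continuousOn hq.continuousOn
  have hle := norm_pair_le_of_hasDerivAt hy hy' (le_max_left 1 K)
    (fun z hz => (hK z hz).trans (le_max_right 1 K)) hz
  rw [h0, h0', Prod.mk_zero_zero, norm_zero, zero_mul] at hle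
  exact norm_le_zero_iff.1 ((norm_fst_le (y z, y' z)).trans hle)

/-- `y` solves the initial value problem `y'' = q y`, `y(0) = 0`, `y'(0) = a`, which the shooting
method attaches to a Dirichlet condition at `0`. -/
structure IsShootingSolution (q : ℝ → ℝ) (a : ℝ) (y : ℝ → ℝ) : Prop extends IsSolution q y where
  map_zero : y 0 = 0
  deriv_zero : deriv y 0 = a

theorem IsShootingSolution.of_hasDerivAt {q y y' : ℝ → ℝ} {a : ℝ}
    (h : ∀ z, HasDerivAt y (y' z) z) (h' : ∀ z, HasDerivAt y' (q z * y z) z) (h0 : y 0 = 0)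
    (h0' : y' 0 = a) : IsShootingSolution q a y where
  toIsSolution := .of_hasDerivAt h h'
  map_zero := h0
  deriv_zero := (h 0).deriv.trans h0'

theorem IsShootingSolution.comp_neg {q y : ℝ → ℝ} {a : ℝ} (h : IsShootingSolution q a y) :
    IsShootingSolution (fun z => q (-z)) (-a) fun z => y (-z) where
  toIsSolution := h.toIsSolution.comp_neg
  map_zero := by rw [neg_zero, h.map_zero]
  deriv_zero := by rw [deriv_comp_neg, neg_zero, h.deriv_zero]

theorem IsShootingSolution.norm_pair_le {q y : ℝ → ℝ} {a K M : ℝ} (h : IsShootingSolution q a y)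
    (hK : 1 ≤ K) (hq : ∀ z, |z| ≤ M → |q z| ≤ K) {z : ℝ} (hz : |z| ≤ M) :
    ‖(y z, deriv y z)‖ ≤ |a| * Real.exp (K * |z|) := by
  wlog hz0 : 0 ≤ z generalizing q a y z
  · simpa [deriv_comp_neg] using this h.comp_neg (fun u hu => hq (-u) (by rwa [abs_neg]))
      (z := -z) (by rwa [abs_neg]) (by linarith)
  rw [abs_of_nonneg hz0] at hz ⊢
  simpa [h.map_zero, h.deriv_zero] using norm_pair_le_of_hasDerivAt (fun u _ => h.hasDerivAt u)
    (fun u _ => h.hasDerivAt_deriv u) hK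
    (fun u hu => hq u (by rw [abs_of_nonneg hu.1]; exact hu.2)) ⟨hz0, hz⟩

section Limit

variable {ι : Type*} {l : Filter ι}

theorem tendsto_sub_of_tendsto_deriv [l.IsCountablyGenerated] {f f' : ι → ℝ → ℝ} {g : ℝ → ℝ}
    {z B : ℝ} (hf : ∀ᶠ i in l, ∀ u, HasDerivAt (f i) (f' i u) u)
    (hf' : ∀ᶠ i in l, Continuous (f' i)) (hB : ∀ᶠ i in l, ∀ u, |u| ≤ |z| → |f' i u| ≤ B)
    (hlim : ∀ u, Tendsto (fun i => f' i u) l (𝓝 (g u))) :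
    Tendsto (fun i => f i z - f i 0) l (𝓝 (∫ u in (0 : ℝ)..z, g u)) := by
  have hint : Tendsto (fun i => ∫ u in (0 : ℝ)..z, f' i u) l (𝓝 (∫ u in (0 : ℝ)..z, g u)) := by
    refine intervalIntegral.tendsto_integral_filter_of_dominated_convergence (fun _ => B)
      (hf'.mono fun i hi => hi.aestronglyMeasurable) ?_ intervalIntegrable_const
      (.of_forall fun u _ => hlim u)
    filter_upwards [hB] with i hi
    refine .of_forall fun u hu => hi u ?_
    simpa using abs_sub_left_of_mem_uIcc (uIoc_subset_uIcc hu)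
  refine hint.congr' ?_
  filter_upwards [hf, hf'] with i hi hi'
  exact intervalIntegral.integral_eq_sub_of_hasDerivAt (fun u _ => hi u)
    (hi'.intervalIntegrable _ _)

theorem continuous_of_tendsto_of_deriv_bounded [l.NeBot] {f : ι → ℝ → ℝ} {g : ℝ → ℝ}
    (hf : ∀ᶠ i in l, Differentiable ℝ (f i))
    (hB : ∀ M : ℝ, ∃ B, ∀ᶠ i in l, ∀ z, |z| ≤ M → |deriv (f i) z| ≤ B)
    (hlim : ∀ z, Tendsto (fun i => f i z) l (𝓝 (g z))) : Continuous g := by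
  refine continuous_iff_continuousAt.2 fun z => ?_
  obtain ⟨B, hB⟩ := hB (|z| + 1)
  have hlip : LipschitzOnWith B.toNNReal g (Metric.closedBall 0 (|z| + 1)) := by
    refine isClosed_setOfPred_lipschitzOnWith (B.toNNReal) (Metric.closedBall 0 (|z| + 1))
      |>.mem_of_tendsto (tendsto_pi_nhds.2 hlim) ?_
    filter_upwards [hf, hB] with i hi hiB
    refine (convex_closedBall _ _).lipschitzOnWith_of_nnnorm_deriv_le (fun u _ => hi u)
      fun u hu => ?_
    exact NNReal.le_toNNReal_of_coe_le (hiB u (mem_closedBall_zero_iff.1 hu))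
  exact hlip.continuousOn.continuousAt
    (Metric.closedBall_mem_nhds_of_mem (by simp))

theorem IsShootingSolution.exists_eventually_abs_deriv_le {q y : ι → ℝ → ℝ} {a M K : ℝ}
    (hsol : ∀ᶠ i in l, IsShootingSolution (q i) a (y i))
    (hK : ∀ᶠ i in l, ∀ z, |z| ≤ M → |q i z| ≤ K) :
    ∃ B, ∀ᶠ i in l, ∀ z, |z| ≤ M → |deriv (y i) z| ≤ B ∧ |q i z * y i z| ≤ B := by
  set K' := max 1 K
  refine ⟨K' * (|a| * Real.exp (K' * M)), ?_⟩
  filter_upwards [hsol, hK] with i hi hiK z hz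
  have hq' u (hu : |u| ≤ M) : |q i u| ≤ K' := (hiK u hu).trans (le_max_right 1 K)
  have hK' : 1 ≤ K' := le_max_left 1 K
  have hle : ‖(y i z, deriv (y i) z)‖ ≤ |a| * Real.exp (K' * M) :=
    (hi.norm_pair_le hK' hq' hz).trans (by gcongr)
  constructor
  · exact ((norm_snd_le (y i z, deriv (y i) z)).trans hle).trans
      (le_mul_of_one_le_left (by positivity) hK')
  · rw [abs_mul]
    exact mul_le_mul (hq' z hz) ((norm_fst_le (y i z, deriv (y i) z)).trans hle) (abs_nonneg _)
      (zero_le_one.trans hK')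

/-- The growth bound makes the derivatives locally bounded, so that dominated convergence passes to
the limit in the integrated equations for `y` and `y'`. -/
theorem IsShootingSolution.of_tendsto [l.NeBot] [l.IsCountablyGenerated] {q y : ι → ℝ → ℝ} {a : ℝ}
    {q₀ y₀ : ℝ → ℝ} (hsol : ∀ᶠ i in l, IsShootingSolution (q i) a (y i))
    (hq : ∀ i, Continuous (q i)) (hq₀ : Continuous q₀)
    (hqlim : ∀ z, Tendsto (fun i => q i z) l (𝓝 (q₀ z)))
    (hqbdd : ∀ M : ℝ, ∃ K, ∀ᶠ i in l, ∀ z, |z| ≤ M → |q i z| ≤ K)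
    (hylim : ∀ z, Tendsto (fun i => y i z) l (𝓝 (y₀ z))) : IsShootingSolution q₀ a y₀ := by
  choose B hB using fun M => exists_eventually_abs_deriv_le hsol (hqbdd M).choose_spec
  have hcont : Continuous y₀ := continuous_of_tendsto_of_deriv_bounded
    (hsol.mono fun i hi => hi.differentiable)
    (fun M => ⟨B M, (hB M).mono fun i hi z hz => (hi z hz).1⟩) hylim
  have hy₀0 : y₀ 0 = 0 := tendsto_nhds_unique (hylim 0)
    (tendsto_const_nhds.congr' (hsol.mono fun i hi => hi.map_zero.symm))
  set p : ℝ → ℝ := fun z => a + ∫ u in (0 : ℝ)..z, q₀ u * y₀ u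
  have hp z : HasDerivAt p (q₀ z * y₀ z) z :=
    ((hq₀.mul hcont).integral_hasStrictDerivAt 0 z).hasDerivAt.const_add a
  have hderivlim z : Tendsto (fun i => deriv (y i) z) l (𝓝 (p z)) := by
    refine ((tendsto_sub_of_tendsto_deriv (hsol.mono fun i hi => hi.hasDerivAt_deriv)
      (hsol.mono fun i hi => (hq i).mul hi.continuous)
      ((hB |z|).mono fun i hi u hu => (hi u hu).2)
      fun u => (hqlim u).mul (hylim u)).const_add a).congr' ?_
    filter_upwards [hsol] with i hi
    rw [hi.deriv_zero, add_sub_cancel]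
  have hy₀ : y₀ = fun z => ∫ u in (0 : ℝ)..z, p u := by
    funext z
    have := tendsto_nhds_unique ((hylim z).sub (hylim 0)) <|
      tendsto_sub_of_tendsto_deriv (hsol.mono fun i hi => hi.hasDerivAt)
        (hsol.mono fun i hi => hi.continuous_deriv)
        ((hB |z|).mono fun i hi u hu => (hi u hu).1) hderivlim
    rwa [hy₀0, sub_zero] at this
  have hpc : Continuous p := continuous_iff_continuousAt.2 fun z => (hp z).continuousAt
  exact .of_hasDerivAt (y' := p)
    (fun z => hy₀ ▸ (hpc.integral_hasStrictDerivAt 0 z).hasDerivAt) hp hy₀0 (by simp [p])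

end Limit

/-! ### Orthogonal families and frame operators -/

section Orthogonal

variable {ι V : Type*} [NormedAddCommGroup V] [InnerProductSpace ℝ V] {v : ι → V}

theorem starProjection_span_image_eq_sum (hv : Pairwise fun i j => ⟪v i, v j⟫ = 0) (T : Finset ι)
    [(Submodule.span ℝ (v '' T)).HasOrthogonalProjection] (x : V) :
    (Submodule.span ℝ (v '' T)).starProjection x = ∑ i ∈ T, (⟪v i, x⟫ / ⟪v i, v i⟫) • v i := by
  refine Submodule.eq_starProjection_of_mem_of_inner_eq_zero ?_ fun f hf => ?_
  · exact Submodule.sum_mem _ fun i hi =>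
      Submodule.smul_mem _ _ (Submodule.subset_span (mem_image_of_mem v hi))
  · have hperp : Submodule.span ℝ (v '' T) ≤
        (Submodule.span ℝ {x - ∑ i ∈ T, (⟪v i, x⟫ / ⟪v i, v i⟫) • v i})ᗮ := by
      rw [Submodule.span_le]
      rintro _ ⟨j, hj, rfl⟩
      rw [SetLike.mem_coe, Submodule.mem_orthogonal_singleton_iff_inner_left, inner_sub_right,
        inner_sum, Finset.sum_eq_single_of_mem j hj fun i _ hij => by
          rw [inner_smul_right, hv hij.symm, mul_zero],
        inner_smul_right, div_mul_cancel_of_imp, sub_self]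
      intro h
      rw [inner_self_eq_zero.1 h, inner_zero_left]
    exact Submodule.mem_orthogonal_singleton_iff_inner_right.1 (hperp hf)

theorem sum_inner_sq_div_le_norm_sq (hv : Pairwise fun i j => ⟪v i, v j⟫ = 0) (T : Finset ι)
    (x : V) : ∑ i ∈ T, ⟪v i, x⟫ ^ 2 / ⟪v i, v i⟫ ≤ ‖x‖ ^ 2 := by
  have : FiniteDimensional ℝ (Submodule.span ℝ (v '' T)) :=
    .span_of_finite ℝ (T.finite_toSet.image v)
  set P := (Submodule.span ℝ (v '' T)).starProjection
  calc ∑ i ∈ T, ⟪v i, x⟫ ^ 2 / ⟪v i, v i⟫ = ⟪P x, x⟫ := by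
        simp only [P, starProjection_span_image_eq_sum hv, sum_inner, real_inner_smul_left]
        exact Finset.sum_congr rfl fun i _ => by ring
    _ ≤ ‖P x‖ * ‖x‖ := real_inner_le_norm _ _
    _ ≤ ‖x‖ * ‖x‖ := by gcongr; exact Submodule.norm_starProjection_apply_le _ x
    _ = ‖x‖ ^ 2 := (sq _).symm

theorem hasSum_of_mem_closure_span [CompleteSpace V] (hv : Pairwise fun i j => ⟪v i, v j⟫ = 0)
    {x : V} (hx : x ∈ (Submodule.span ℝ (range v)).topologicalClosure) :
    HasSum (fun i => (⟪v i, x⟫ / ⟪v i, v i⟫) • v i) x := by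
  have (T : Finset ι) : FiniteDimensional ℝ (Submodule.span ℝ (v '' T)) :=
    .span_of_finite ℝ (T.finite_toSet.image v)
  have hsup : ⨆ T : Finset ι, Submodule.span ℝ (v '' T) = Submodule.span ℝ (range v) := by
    rw [← Submodule.span_iUnion, ← image_iUnion, iUnion_eq_univ_iff.2 fun i => ⟨{i}, by simp⟩,
      image_univ]
  have hlim := Submodule.starProjection_tendsto_closure_iSup
    (fun T : Finset ι => Submodule.span ℝ (v '' T))
    (fun S T hST => Submodule.span_mono (image_mono (Finset.coe_subset.2 hST))) x
  rw [hsup, Submodule.starProjection_eq_self_iff.2 hx] at hlim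
  exact hlim.congr fun T => starProjection_span_image_eq_sum hv T x

theorem tendstoUniformlyOn_inner {X : Type*} {e : X → V} {S : Set X} {C : ℝ}
    (he : ∀ t ∈ S, ‖e t‖ ≤ C) {l : Filter ι} {x : V} (hv : Tendsto v l (𝓝 x)) :
    TendstoUniformlyOn (fun i t => ⟪e t, v i⟫) (fun t => ⟪e t, x⟫) l S := by
  rw [Metric.tendstoUniformlyOn_iff]
  intro ε hε
  have hsmall : Tendsto (fun i => |C| * ‖x - v i‖) l (𝓝 0) := by
    simpa using ((tendsto_const_nhds (x := x)).sub hv).norm.const_mul |C|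
  filter_upwards [hsmall.eventually_lt_const hε] with i hi t ht
  rw [Real.dist_eq, ← inner_sub_right]
  refine (abs_real_inner_le_norm _ _).trans_lt (lt_of_le_of_lt ?_ hi)
  gcongr
  exact (he t ht).trans (le_abs_self C)

end Orthogonal

section FrameOperator

variable {V : Type*} [NormedAddCommGroup V] [InnerProductSpace ℝ V]

/-- The frame operator `∫ x in a..b, w x • e x ⊗ e x` of a weighted continuous family of vectors;
its eigenvectors correspond to the eigenfunctions of the integral operator on `L²(w dx)` with
kernel `⟪e x, e z⟫`. -/
noncomputable def frameOperator (a b : ℝ) (w : ℝ → ℝ) (e : ℝ → V) : V →L[ℝ] V :=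
  ∫ x in a..b, w x • InnerProductSpace.rankOne ℝ (e x) (e x)

variable {a b : ℝ} {w : ℝ → ℝ} {e : ℝ → V}

theorem continuous_smul_rankOne (hw : Continuous w) (he : Continuous e) :
    Continuous fun x => w x • InnerProductSpace.rankOne ℝ (e x) (e x) :=
  hw.smul (((InnerProductSpace.rankOne ℝ).continuous.comp he).clm_apply he)

theorem frameOperator_apply (hw : Continuous w) (he : Continuous e) (f : V) :
    frameOperator a b w e f = ∫ x in a..b, (w x * ⟪e x, f⟫) • e x := by
  rw [frameOperator, ContinuousLinearMap.intervalIntegral_apply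
    ((continuous_smul_rankOne hw he).intervalIntegrable _ _)]
  simp only [smul_apply, InnerProductSpace.rankOne_apply, smul_smul]

variable [CompleteSpace V]

theorem inner_intervalIntegral_smul {g : ℝ → ℝ} (hg : Continuous g) (he : Continuous e) (f : V) :
    ⟪f, ∫ x in a..b, g x • e x⟫ = ∫ x in a..b, g x * ⟪f, e x⟫ := by
  simpa [real_inner_smul_right] using ((innerSL ℝ f).intervalIntegral_comp_comm
    (μ := MeasureTheory.volume) ((hg.smul he).intervalIntegrable a b)).symm

theorem inner_frameOperator (hw : Continuous w) (he : Continuous e) (f g : V) :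
    ⟪g, frameOperator a b w e f⟫ = ∫ x in a..b, w x * ⟪e x, f⟫ * ⟪e x, g⟫ := by
  rw [frameOperator_apply hw he,
    inner_intervalIntegral_smul (g := fun x => w x * ⟪e x, f⟫) (by fun_prop) he]
  simp only [real_inner_comm g]

theorem inner_frameOperator_self (hw : Continuous w) (he : Continuous e) (f : V) :
    ⟪f, frameOperator a b w e f⟫ = ∫ x in a..b, w x * ⟪e x, f⟫ ^ 2 := by
  simp only [inner_frameOperator hw he, sq, mul_assoc]

theorem isSymmetric_frameOperator (hw : Continuous w) (he : Continuous e) :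
    (frameOperator a b w e).IsSymmetric := by
  intro f g
  rw [real_inner_comm]
  simp only [ContinuousLinearMap.coe_coe, inner_frameOperator hw he, mul_right_comm]

theorem isCompactOperator_frameOperator (hw : Continuous w) (he : Continuous e) :
    IsCompactOperator (frameOperator a b w e) := by
  set K := compactOperator (RingHom.id ℝ) V V
  have hK : IsClosed (K : Set (V →L[ℝ] V)) := isClosed_setOfPred_isCompactOperator
  have : CompleteSpace K := hK.completeSpace_coe
  have hmem x : w x • InnerProductSpace.rankOne ℝ (e x) (e x) ∈ K := by
    refine K.smul_mem _ (?_ : IsCompactOperator (InnerProductSpace.rankOne ℝ (e x) (e x)))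
    rw [InnerProductSpace.rankOne_def']
    exact (isCompactOperator_of_locallyCompactSpace_dom (innerSL ℝ (e x))).clm_comp
      (ContinuousLinearMap.toSpanSingleton ℝ (e x))
  have hcont : Continuous fun x => (⟨_, hmem x⟩ : K) :=
    (continuous_smul_rankOne hw he).subtype_mk hmem
  have hcomm := ContinuousLinearMap.intervalIntegral_comp_comm (𝕜 := ℝ) (E := K)
    (μ := MeasureTheory.volume) K.subtypeL (hcont.intervalIntegrable a b)
  rw [show frameOperator a b w e = K.subtypeL (∫ x in a..b, (⟨_, hmem x⟩ : K)) from hcomm]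
  exact (∫ x in a..b, (⟨_, hmem x⟩ : K)).2

theorem inner_eq_zero_of_frameOperator_eq_zero (hw : Continuous w) (hpos : ∀ x, 0 < w x)
    (he : Continuous e) (hab : a < b) {f : V} (hf : frameOperator a b w e f = 0) {x : ℝ}
    (hx : x ∈ Icc a b) : ⟪e x, f⟫ = 0 := by
  by_contra hne
  have hint : 0 < ∫ x in a..b, w x * ⟪e x, f⟫ ^ 2 :=
    intervalIntegral.integral_pos hab (by fun_prop)
      (fun z _ => mul_nonneg (hpos z).le (sq_nonneg _))
      ⟨x, hx, mul_pos (hpos x) (by positivity)⟩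
  rw [← inner_frameOperator_self hw he, hf, inner_zero_right] at hint
  exact hint.false

theorem eigenvalue_nonneg_of_frameOperator_eq_smul (hw : Continuous w) (hnn : ∀ x, 0 ≤ w x)
    (he : Continuous e) (hab : a ≤ b) {f : V} (hf0 : f ≠ 0) {μ : ℝ}
    (hf : frameOperator a b w e f = μ • f) : 0 ≤ μ := by
  have hint : 0 ≤ ∫ x in a..b, w x * ⟪e x, f⟫ ^ 2 :=
    intervalIntegral.integral_nonneg hab fun x _ => mul_nonneg (hnn x) (sq_nonneg _)
  rw [← inner_frameOperator_self hw he, hf, real_inner_smul_right] at hint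
  exact nonneg_of_mul_nonneg_left hint (real_inner_self_pos.2 hf0)

/-- A vector orthogonal to `W` is mapped by the symmetric operator into the orthogonal complement
of all eigenspaces, which is trivial by the spectral theorem. -/
theorem mem_topologicalClosure_of_frameOperator_eigenvectors (hw : Continuous w)
    (hpos : ∀ x, 0 < w x) (he : Continuous e) (hab : a < b) {W : Submodule ℝ V}
    (hW : ∀ μ : ℝ, μ ≠ 0 → ∀ f, frameOperator a b w e f = μ • f → f ∈ W) {x : ℝ}
    (hx : x ∈ Icc a b) : e x ∈ W.topologicalClosure := by
  rw [← W.orthogonal_orthogonal_eq_closure, Submodule.mem_orthogonal']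
  intro f hf
  refine inner_eq_zero_of_frameOperator_eq_zero hw hpos he hab ?_ hx
  have hsym := isSymmetric_frameOperator (a := a) (b := b) hw he
  rw [← Submodule.mem_bot ℝ, ← ContinuousLinearMap.orthogonalComplement_iSup_eigenspaces_eq_bot
    (isCompactOperator_frameOperator (a := a) (b := b) hw he) hsym, Submodule.mem_orthogonal]
  have hperp : (⨆ μ, Module.End.eigenspace (frameOperator a b w e : Module.End ℝ V) μ) ≤
      (Submodule.span ℝ {frameOperator a b w e f})ᗮ := by
    refine iSup_le fun μ g hg => ?_
    rw [Module.End.mem_eigenspace_iff] at hg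
    rw [Submodule.mem_orthogonal_singleton_iff_inner_left]
    refine (hsym g f).symm.trans ?_
    rw [hg, real_inner_smul_left]
    obtain rfl | hμ := eq_or_ne μ 0
    · exact zero_mul _
    · rw [(W.mem_orthogonal f).1 hf g (hW μ hμ g hg), mul_zero]
  exact fun g hg => Submodule.mem_orthogonal_singleton_iff_inner_left.1 (hperp hg)

theorem inner_eq_zero_of_frameOperator_eq_smul (hw : Continuous w) (he : Continuous e) {f g : V}
    {μ η : ℝ} (hf : frameOperator a b w e f = μ • f) (hg : frameOperator a b w e g = η • g)
    (hne : μ ≠ η) : ⟪f, g⟫ = 0 :=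
  (isSymmetric_frameOperator (a := a) (b := b) hw he).orthogonalFamily_eigenspaces hne
    ⟨f, Module.End.mem_eigenspace_iff.2 hf⟩ ⟨g, Module.End.mem_eigenspace_iff.2 hg⟩

/-- The trace of the frame operator is `∫ x in a..b, w x * ‖e x‖ ^ 2`. -/
theorem sum_eigenvalues_frameOperator_le {ι : Type*} {f : ι → V} {μ : ι → ℝ} (hw : Continuous w)
    (hnn : ∀ x, 0 ≤ w x) (he : Continuous e) (hab : a ≤ b)
    (horth : Pairwise fun i j => ⟪f i, f j⟫ = 0) (hf0 : ∀ i, f i ≠ 0)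
    (hf : ∀ i, frameOperator a b w e (f i) = μ i • f i) (T : Finset ι) :
    ∑ i ∈ T, μ i ≤ ∫ x in a..b, w x * ‖e x‖ ^ 2 := by
  have heigen i : μ i = ∫ x in a..b, w x * (⟪f i, e x⟫ ^ 2 / ⟪f i, f i⟫) := by
    simp only [← mul_div_assoc, intervalIntegral.integral_div, real_inner_comm (e _),
      ← inner_frameOperator_self hw he]
    rw [hf, real_inner_smul_right, mul_div_cancel_right₀ _ (inner_self_ne_zero.2 (hf0 i))]
  have hcont i : Continuous fun x => w x * (⟪f i, e x⟫ ^ 2 / ⟪f i, f i⟫) := by fun_prop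
  calc ∑ i ∈ T, μ i = ∫ x in a..b, ∑ i ∈ T, w x * (⟪f i, e x⟫ ^ 2 / ⟪f i, f i⟫) := by
        rw [intervalIntegral.integral_finsetSum fun i _ => (hcont i).intervalIntegrable _ _]
        exact Finset.sum_congr rfl fun i _ => heigen i
    _ ≤ ∫ x in a..b, w x * ‖e x‖ ^ 2 := by
        refine intervalIntegral.integral_mono_on hab
          ((continuous_finsetSum T fun i _ => hcont i).intervalIntegrable _ _)
          ((by fun_prop : Continuous fun x => w x * ‖e x‖ ^ 2).intervalIntegrable _ _)
          fun x _ => ?_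
        rw [← Finset.mul_sum]
        exact mul_le_mul_of_nonneg_left (sum_inner_sq_div_le_norm_sq horth T (e x)) (hnn x)

end FrameOperator

/-! ### Green functions -/

/-- `u` and `v` solve `y'' = q y` and vanish at `0` and at `L` respectively, so that
`u (min x z) * v (max x z)` is the Green function of `-y'' + q y` on `[0, L]` with Dirichlet
conditions. As `u` vanishes at `0`, `normalized` says that the Wronskian `u' v - u v'` is `1`. -/
structure IsDirichletPair (q : ℝ → ℝ) (L : ℝ) (u v : ℝ → ℝ) : Prop where
  length_pos : 0 < L
  left : IsSolution q u
  right : IsSolution q v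
  left_zero : u 0 = 0
  right_length : v L = 0
  normalized : deriv u 0 * v 0 = 1
  right_pos : ∀ x ∈ Ico 0 L, 0 < v x

/-- The Green function attached to a Dirichlet pair `u`, `v`. -/
def greenKernel (u v : ℝ → ℝ) (x z : ℝ) : ℝ :=
  u (min x z) * v (max x z)

/-- The integral `∫ z in 0..L, greenKernel u v x z * g z` of the Green function against a source
term `g`, split at `z = x` so that it can be differentiated in `x`. -/
noncomputable def greenIntegral (u v : ℝ → ℝ) (L : ℝ) (g : ℝ → ℝ) (x : ℝ) : ℝ :=
  v x * (∫ z in (0 : ℝ)..x, g z * u z) + u x * ∫ z in x..L, g z * v z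

theorem greenIntegral_const_mul (u v : ℝ → ℝ) (L c : ℝ) (g : ℝ → ℝ) (x : ℝ) :
    greenIntegral u v L (fun z => c * g z) x = c * greenIntegral u v L g x := by
  simp only [greenIntegral, mul_assoc, intervalIntegral.integral_const_mul]
  ring

namespace IsDirichletPair

variable {q p u v y g : ℝ → ℝ} {L : ℝ}

theorem wronskian (h : IsDirichletPair q L u v) (x : ℝ) :
    deriv u x * v x - u x * deriv v x = 1 := by
  rw [h.left.wronskian_eq h.right, h.left_zero, h.normalized, zero_mul, sub_zero]

theorem monotoneOn_div (h : IsDirichletPair q L u v) :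
    MonotoneOn (fun x => u x / v x) (Ico 0 L) := by
  have hderiv x (hx : x ∈ Ico 0 L) : HasDerivAt (fun x => u x / v x) ((v x ^ 2)⁻¹) x :=
    ((h.left.hasDerivAt x).div (h.right.hasDerivAt x) (h.right_pos x hx).ne').congr_deriv <| by
      rw [h.wronskian x, one_div]
  exact monotoneOn_of_hasDerivWithinAt_nonneg (convex_Ico 0 L)
    (fun x hx => (hderiv x hx).continuousAt.continuousWithinAt)
    (fun x hx => (hderiv x (interior_subset hx)).hasDerivWithinAt) fun x _ => by positivity

theorem div_nonneg (h : IsDirichletPair q L u v) {x : ℝ} (hx : x ∈ Ico 0 L) : 0 ≤ u x / v x := by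
  simpa [h.left_zero] using h.monotoneOn_div (left_mem_Ico.2 h.length_pos) hx hx.1

theorem continuous_greenKernel (h : IsDirichletPair q L u v) :
    Continuous fun x : ℝ × ℝ => greenKernel u v x.1 x.2 :=
  (h.left.continuous.comp (continuous_fst.min continuous_snd)).mul
    (h.right.continuous.comp (continuous_fst.max continuous_snd))

/-- The one-sided derivatives at the diagonal differ by the Wronskian. -/
theorem not_differentiableAt_greenKernel (h : IsDirichletPair q L u v) (s : ℝ) :
    ¬ DifferentiableAt ℝ (fun x => greenKernel u v x s) s := by
  intro hd
  have hleft : deriv (fun x => greenKernel u v x s) s = deriv u s * v s :=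
    (uniqueDiffWithinAt_Iic s).eq_deriv _ hd.hasDerivAt.hasDerivWithinAt <|
      ((h.left.hasDerivAt s).mul_const (v s)).hasDerivWithinAt.congr
        (fun x hx => by rw [greenKernel, min_eq_left hx, max_eq_right hx])
        (by rw [greenKernel, min_self, max_self])
  have hright : deriv (fun x => greenKernel u v x s) s = u s * deriv v s :=
    (uniqueDiffWithinAt_Ici s).eq_deriv _ hd.hasDerivAt.hasDerivWithinAt <|
      ((h.right.hasDerivAt s).const_mul (u s)).hasDerivWithinAt.congr
        (fun x hx => by rw [greenKernel, min_eq_right hx, max_eq_left hx])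
        (by rw [greenKernel, min_self, max_self])
  linarith [h.wronskian s]

theorem integral_greenKernel (h : IsDirichletPair q L u v) (hg : Continuous g) {x : ℝ}
    (hx : x ∈ Icc 0 L) :
    ∫ z in (0 : ℝ)..L, g z * greenKernel u v x z = greenIntegral u v L g x := by
  have hc : Continuous fun z => g z * greenKernel u v x z :=
    hg.mul (h.continuous_greenKernel.comp (Continuous.prodMk_right x))
  rw [greenIntegral, ← intervalIntegral.integral_add_adjacent_intervals (hc.intervalIntegrable 0 x)
    (hc.intervalIntegrable x L), ← intervalIntegral.integral_const_mul,
    ← intervalIntegral.integral_const_mul]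
  congr 1 <;> refine intervalIntegral.integral_congr fun z hz => ?_
  · rw [uIcc_of_le hx.1] at hz
    simp only [greenKernel, min_eq_right hz.2, max_eq_left hz.2]
    ring
  · rw [uIcc_of_le hx.2] at hz
    simp only [greenKernel, min_eq_left hz.1, max_eq_right hz.1]
    ring

theorem greenIntegral_zero (h : IsDirichletPair q L u v) : greenIntegral u v L g 0 = 0 := by
  simp [greenIntegral, h.left_zero]

theorem greenIntegral_length (h : IsDirichletPair q L u v) : greenIntegral u v L g L = 0 := by
  simp [greenIntegral, h.right_length]

theorem hasDerivAt_greenIntegral (h : IsDirichletPair q L u v) (hg : Continuous g) (x : ℝ) :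
    HasDerivAt (greenIntegral u v L g)
      (deriv v x * (∫ z in (0 : ℝ)..x, g z * u z) + deriv u x * ∫ z in x..L, g z * v z) x := by
  have hleft := (hg.mul h.left.continuous).integral_hasStrictDerivAt 0 x |>.hasDerivAt
  have hright := intervalIntegral.integral_hasDerivAt_left
    ((hg.mul h.right.continuous).intervalIntegrable x L)
    ((hg.mul h.right.continuous).stronglyMeasurableAtFilter _ _)
    (hg.mul h.right.continuous).continuousAt
  refine (((h.right.hasDerivAt x).mul hleft).add ((h.left.hasDerivAt x).mul hright)).congr_deriv ?_
  simp only [Pi.mul_apply]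
  ring

theorem hasDerivAt_deriv_greenIntegral (h : IsDirichletPair q L u v) (hg : Continuous g) (x : ℝ) :
    HasDerivAt (deriv (greenIntegral u v L g)) (q x * greenIntegral u v L g x - g x) x := by
  rw [show deriv (greenIntegral u v L g) = _ from
    funext fun x => (h.hasDerivAt_greenIntegral hg x).deriv]
  have hleft := (hg.mul h.left.continuous).integral_hasStrictDerivAt 0 x |>.hasDerivAt
  have hright := intervalIntegral.integral_hasDerivAt_left
    ((hg.mul h.right.continuous).intervalIntegrable x L)
    ((hg.mul h.right.continuous).stronglyMeasurableAtFilter _ _)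
    (hg.mul h.right.continuous).continuousAt
  refine (((h.right.hasDerivAt_deriv x).mul hleft).add
    ((h.left.hasDerivAt_deriv x).mul hright)).congr_deriv ?_
  simp only [Pi.mul_apply, greenIntegral]
  linear_combination (-g x) * h.wronskian x

/-- Green's representation: both integrals telescope to Wronskians by Lagrange's identity. -/
theorem greenIntegral_eq_self (h : IsDirichletPair q L u v) (hq : Continuous q)
    (hp : Continuous p) (hy : IsSolution p y) (hy0 : y 0 = 0) (hyL : y L = 0) (x : ℝ) :
    greenIntegral u v L (fun z => (q z - p z) * y z) x = y x := by
  have hint {f : ℝ → ℝ} (hf : IsSolution q f) (a b : ℝ) :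
      ∫ z in a..b, (q z - p z) * y z * f z =
        deriv f b * y b - f b * deriv y b - (deriv f a * y a - f a * deriv y a) := by
    have hc := ((hq.sub hp).mul hf.continuous).mul hy.continuous
    rw [← intervalIntegral.integral_eq_sub_of_hasDerivAt
      (fun z _ => hf.hasDerivAt_wronskian hy z) (hc.intervalIntegrable a b)]
    exact intervalIntegral.integral_congr fun z _ => mul_right_comm _ _ _
  rw [greenIntegral, hint h.left, hint h.right, hy0, hyL, h.left_zero, h.right_length]
  linear_combination y x * h.wronskian x

end IsDirichletPair

section Feature

variable {V : Type*} [NormedAddCommGroup V] [InnerProductSpace ℝ V] {q u v : ℝ → ℝ} {L : ℝ}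

/-- `e` is a continuous family of vectors whose Gram matrix on `[0, L]` is the Green function of a
Dirichlet pair. -/
structure IsGreenFeature (q : ℝ → ℝ) (L : ℝ) (u v : ℝ → ℝ) (e : ℝ → V) : Prop
    extends IsDirichletPair q L u v where
  continuous : Continuous e
  inner_eq : ∀ x ∈ Icc 0 L, ∀ z ∈ Icc 0 L, ⟪e x, e z⟫ = greenKernel u v x z

theorem continuous_of_continuous_inner {X : Type*} [TopologicalSpace X] {e : X → V}
    (he : Continuous fun x : X × X => ⟪e x.1, e x.2⟫) : Continuous e := by
  refine continuous_iff_continuousAt.2 fun x => tendsto_iff_norm_sub_tendsto_zero.2 ?_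
  have hsq z : ‖e z - e x‖ = √(⟪e z, e z⟫ - 2 * ⟪e z, e x⟫ + ⟪e x, e x⟫) := by
    rw [real_inner_self_eq_norm_sq, real_inner_self_eq_norm_sq, ← norm_sub_sq_real,
      Real.sqrt_sq (norm_nonneg _)]
  have hdiag : Continuous fun z => ⟪e z, e z⟫ := he.comp (continuous_id.prodMk continuous_id)
  have hsec : Continuous fun z => ⟪e z, e x⟫ := he.comp (Continuous.prodMk_left x)
  have hcont : Continuous fun z => √(⟪e z, e z⟫ - 2 * ⟪e z, e x⟫ + ⟪e x, e x⟫) := by fun_prop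
  simpa only [hsq, show ⟪e x, e x⟫ - 2 * ⟪e x, e x⟫ + ⟪e x, e x⟫ = 0 by ring, Real.sqrt_zero]
    using hcont.tendsto x

/-- The vector `v x • 1_{(0, u x / v x]}` of `L²(ℝ)`. For `u / v` increasing, intersecting the
intervals turns inner products into `v x * v z * min (u x / v x) (u z / v z)`, which is the Green
function, as for the covariance of Brownian motion. -/
noncomputable def greenFeature (u v : ℝ → ℝ) (x : ℝ) :
    MeasureTheory.Lp ℝ 2 (MeasureTheory.volume : MeasureTheory.Measure ℝ) :=
  v x • MeasureTheory.indicatorConstLp 2 (measurableSet_Ioc (a := 0) (b := u x / v x))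
    measure_Ioc_lt_top.ne 1

theorem IsDirichletPair.inner_greenFeature (h : IsDirichletPair q L u v) {x z : ℝ}
    (hx : x ∈ Icc 0 L) (hz : z ∈ Icc 0 L) :
    ⟪greenFeature u v x, greenFeature u v z⟫ = greenKernel u v x z := by
  wlog hxz : x ≤ z generalizing x z
  · rw [real_inner_comm, this hz hx (le_of_not_ge hxz), greenKernel, greenKernel, min_comm,
      max_comm]
  rw [greenFeature, greenFeature, real_inner_smul_left, real_inner_smul_right, greenKernel,
    min_eq_left hxz, max_eq_right hxz,
    MeasureTheory.L2.real_inner_indicatorConstLp_one_indicatorConstLp_one measurableSet_Ioc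
      measurableSet_Ioc measure_Ioc_lt_top.ne measure_Ioc_lt_top.ne, Ioc_inter_Ioc, max_self]
  obtain rfl | hzL := hz.2.eq_or_lt
  · simp [h.right_length]
  have hxI : x ∈ Ico 0 L := ⟨hx.1, hxz.trans_lt hzL⟩
  rw [min_eq_left (h.monotoneOn_div hxI ⟨hz.1, hzL⟩ hxz),
    Real.volume_real_Ioc_of_le (h.div_nonneg hxI), sub_zero, mul_left_comm,
    mul_div_cancel₀ _ (h.right_pos x hxI).ne', mul_comm]

theorem IsDirichletPair.isGreenFeature (h : IsDirichletPair q L u v) :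
    IsGreenFeature q L u v
      (IccExtend h.length_pos.le fun x : Icc 0 L => greenFeature u v x) where
  toIsDirichletPair := h
  continuous := by
    refine (continuous_of_continuous_inner ?_).Icc_extend'
    simp only [h.inner_greenFeature (Subtype.prop _) (Subtype.prop _)]
    exact h.continuous_greenKernel.comp (continuous_subtype_val.prodMap continuous_subtype_val)
  inner_eq x hx z hz := by
    rw [IccExtend_of_mem _ _ hx, IccExtend_of_mem _ _ hz, h.inner_greenFeature hx hz]

theorem IsGreenFeature.inner_integral [CompleteSpace V] {e : ℝ → V}
    (h : IsGreenFeature q L u v e) {g : ℝ → ℝ} (hg : Continuous g) {x : ℝ} (hx : x ∈ Icc 0 L) :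
    ⟪e x, ∫ z in (0 : ℝ)..L, g z • e z⟫ = greenIntegral u v L g x := by
  rw [inner_intervalIntegral_smul hg h.continuous, ← h.integral_greenKernel hg hx]
  refine intervalIntegral.integral_congr fun z hz => ?_
  rw [uIcc_of_le h.length_pos.le] at hz
  simp only [h.inner_eq x hx z hz]

end Feature

/-! ### Sturm-Liouville expansions -/

/-- The shooting solutions `Y ρ` of the Sturm-Liouville equations `y'' = (q - ρ² w) y`, `ρ > 0`,
with a common slope `a` at the left end point `0`. -/
structure IsSturmFamily (q w : ℝ → ℝ) (a : ℝ) (Y : ℝ → ℝ → ℝ) : Prop where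
  continuous_potential : Continuous q
  continuous_weight : Continuous w
  weight_pos : ∀ z, 0 < w z
  slope_ne_zero : a ≠ 0
  isShootingSolution : ∀ ρ, 0 < ρ → IsShootingSolution (fun z => q z - ρ ^ 2 * w z) a (Y ρ)

/-- The parameters `ρ > 0` for which `Y ρ` also vanishes at `L`: the square roots of the Dirichlet
eigenvalues on `[0, L]`. -/
def sturmZeros (L : ℝ) (Y : ℝ → ℝ → ℝ) : Set ℝ :=
  {ρ | 0 < ρ ∧ Y ρ L = 0}

namespace IsSturmFamily

variable {q w u v : ℝ → ℝ} {L a ρ : ℝ} {Y : ℝ → ℝ → ℝ}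

theorem continuous (hY : IsSturmFamily q w a Y) (hρ : 0 < ρ) : Continuous (Y ρ) :=
  (hY.isShootingSolution ρ hρ).continuous

theorem continuous_weight_mul (hY : IsSturmFamily q w a Y) (hρ : 0 < ρ) :
    Continuous fun z => w z * Y ρ z :=
  hY.continuous_weight.mul (hY.continuous hρ)

theorem continuous_potential_sub (hY : IsSturmFamily q w a Y) (ρ : ℝ) :
    Continuous fun z => q z - ρ ^ 2 * w z :=
  hY.continuous_potential.sub (hY.continuous_weight.const_mul _)

theorem exists_ne_zero (hY : IsSturmFamily q w a Y) (hL : 0 < L) (hρ : 0 < ρ) :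
    ∃ x ∈ Icc 0 L, Y ρ x ≠ 0 := by
  by_contra! hzero
  have hsol := hY.isShootingSolution ρ hρ
  refine hY.slope_ne_zero (hsol.deriv_zero.symm.trans ?_)
  exact (uniqueDiffOn_Icc hL 0 (left_mem_Icc.2 hL.le)).eq_deriv _
    (hsol.hasDerivAt 0).hasDerivWithinAt
    ((hasDerivWithinAt_const 0 _ 0).congr hzero (hzero 0 (left_mem_Icc.2 hL.le)))

theorem integral_sq_pos (hY : IsSturmFamily q w a Y) (hL : 0 < L) (hρ : 0 < ρ) :
    0 < ∫ z in (0 : ℝ)..L, w z * Y ρ z ^ 2 := by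
  obtain ⟨x, hx, hne⟩ := hY.exists_ne_zero hL hρ
  exact intervalIntegral.integral_pos hL
    (hY.continuous_weight.mul ((hY.continuous hρ).pow 2)).continuousOn
    (fun z _ => mul_nonneg (hY.weight_pos z).le (sq_nonneg _))
    ⟨x, hx, mul_pos (hY.weight_pos x) (by positivity)⟩

theorem greenIntegral_eq (hY : IsSturmFamily q w a Y) (h : IsDirichletPair q L u v)
    (hρ : ρ ∈ sturmZeros L Y) (x : ℝ) :
    greenIntegral u v L (fun z => w z * Y ρ z) x = Y ρ x / ρ ^ 2 := by
  have hsol := hY.isShootingSolution ρ hρ.1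
  have hgreen := h.greenIntegral_eq_self hY.continuous_potential
    (hY.continuous_potential_sub ρ) hsol.toIsSolution hsol.map_zero hρ.2 x
  simp only [sub_sub_cancel, mul_assoc, greenIntegral_const_mul] at hgreen
  rw [← hgreen, mul_div_cancel_left₀ _ (pow_ne_zero 2 hρ.1.ne')]

/-- Both sides of `μ φ = ∫ G w φ` solve the initial value problem defining a multiple of
`Y (√μ)⁻¹`. -/
theorem exists_eq_mul_of_eigenfunction (hY : IsSturmFamily q w a Y) (h : IsDirichletPair q L u v)
    {φ : ℝ → ℝ} (hφ : Continuous φ) {μ : ℝ} (hμ : 0 < μ)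
    (heigen : ∀ x ∈ Icc 0 L, μ * φ x = greenIntegral u v L (fun z => w z * φ z) x) :
    ∃ α, ∀ x ∈ Icc 0 L, φ x = α * Y (√μ)⁻¹ x := by
  have hρ2 : (√μ)⁻¹ ^ 2 = μ⁻¹ := by rw [inv_pow, Real.sq_sqrt hμ.le]
  have hρ : 0 < (√μ)⁻¹ := inv_pos.2 (Real.sqrt_pos.2 hμ)
  set ρ := (√μ)⁻¹
  have hsol := hY.isShootingSolution ρ hρ
  have hg : Continuous fun z => w z * φ z := hY.continuous_weight.mul hφ
  set Φ := greenIntegral u v L fun z => w z * φ z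
  have hdiff x (hx : x ∈ Icc 0 L) : Φ x - deriv Φ 0 / a * Y ρ x = 0 := by
    refine eq_zero_of_hasDerivAt (y := fun x => Φ x - deriv Φ 0 / a * Y ρ x)
      (y' := fun x => deriv Φ x - deriv Φ 0 / a * deriv (Y ρ) x)
      (hY.continuous_potential_sub ρ)
      (fun z _ => (h.hasDerivAt_greenIntegral hg z).differentiableAt.hasDerivAt.sub
        ((hsol.hasDerivAt z).const_mul _))
      (fun z hz => ((h.hasDerivAt_deriv_greenIntegral hg z).sub
        ((hsol.hasDerivAt_deriv z).const_mul _)).congr_deriv ?_) ?_ ?_ hx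
    · simp only [hρ2]
      linear_combination (-w z * μ⁻¹) * heigen z hz + w z * φ z * inv_mul_cancel₀ hμ.ne'
    · simp only [Φ, h.greenIntegral_zero, hsol.map_zero, mul_zero, sub_zero]
    · simp only [hsol.deriv_zero, div_mul_cancel₀ _ hY.slope_ne_zero, sub_self]
  refine ⟨μ⁻¹ * (deriv Φ 0 / a), fun x hx => ?_⟩
  rw [mul_assoc, ← sub_eq_zero.1 (hdiff x hx), ← heigen x hx, inv_mul_cancel_left₀ hμ.ne']

end IsSturmFamily

section Expansion

variable {V : Type*} [NormedAddCommGroup V] [InnerProductSpace ℝ V]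
  {q w u v : ℝ → ℝ} {L a ρ σ : ℝ} {Y : ℝ → ℝ → ℝ} {e : ℝ → V}

/-- The vector representing the function `Y ρ`; for `ρ ∈ sturmZeros L Y` it is an eigenvector of
the frame operator of a Green feature. -/
noncomputable def sturmEigenvector (L : ℝ) (w : ℝ → ℝ) (Y : ℝ → ℝ → ℝ) (e : ℝ → V) (ρ : ℝ) : V :=
  ∫ z in (0 : ℝ)..L, (w z * Y ρ z) • e z

namespace IsGreenFeature

variable [CompleteSpace V]

theorem inner_sturmEigenvector (h : IsGreenFeature q L u v e) (hY : IsSturmFamily q w a Y)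
    (hρ : ρ ∈ sturmZeros L Y) {x : ℝ} (hx : x ∈ Icc 0 L) :
    ⟪e x, sturmEigenvector L w Y e ρ⟫ = Y ρ x / ρ ^ 2 := by
  rw [sturmEigenvector, h.inner_integral (hY.continuous_weight_mul hρ.1) hx,
    hY.greenIntegral_eq h.toIsDirichletPair hρ]

theorem frameOperator_sturmEigenvector (h : IsGreenFeature q L u v e)
    (hY : IsSturmFamily q w a Y) (hρ : ρ ∈ sturmZeros L Y) :
    frameOperator 0 L w e (sturmEigenvector L w Y e ρ) =
      (ρ ^ 2)⁻¹ • sturmEigenvector L w Y e ρ := by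
  rw [frameOperator_apply hY.continuous_weight h.continuous]
  conv_rhs => rw [sturmEigenvector, ← intervalIntegral.integral_smul]
  refine intervalIntegral.integral_congr fun z hz => ?_
  rw [uIcc_of_le h.length_pos.le] at hz
  simp only [h.inner_sturmEigenvector hY hρ hz, smul_smul]
  congr 1
  ring

theorem inner_sturmEigenvector_self (h : IsGreenFeature q L u v e) (hY : IsSturmFamily q w a Y)
    (hρ : ρ ∈ sturmZeros L Y) :
    ⟪sturmEigenvector L w Y e ρ, sturmEigenvector L w Y e ρ⟫ =
      (∫ z in (0 : ℝ)..L, w z * Y ρ z ^ 2) / ρ ^ 2 := by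
  nth_rewrite 2 [sturmEigenvector]
  rw [inner_intervalIntegral_smul (hY.continuous_weight_mul hρ.1) h.continuous,
    ← intervalIntegral.integral_div]
  refine intervalIntegral.integral_congr fun z hz => ?_
  rw [uIcc_of_le h.length_pos.le] at hz
  simp only [real_inner_comm (e z), h.inner_sturmEigenvector hY hρ hz]
  ring

theorem sturmEigenvector_ne_zero (h : IsGreenFeature q L u v e) (hY : IsSturmFamily q w a Y)
    (hρ : ρ ∈ sturmZeros L Y) : sturmEigenvector L w Y e ρ ≠ 0 := by
  rw [← real_inner_self_pos, h.inner_sturmEigenvector_self hY hρ]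
  exact div_pos (hY.integral_sq_pos h.length_pos hρ.1) (pow_pos hρ.1 2)

theorem inner_sturmEigenvector_eq_zero (h : IsGreenFeature q L u v e)
    (hY : IsSturmFamily q w a Y) (hρ : ρ ∈ sturmZeros L Y) (hσ : σ ∈ sturmZeros L Y)
    (hne : ρ ≠ σ) : ⟪sturmEigenvector L w Y e ρ, sturmEigenvector L w Y e σ⟫ = 0 :=
  inner_eq_zero_of_frameOperator_eq_smul hY.continuous_weight h.continuous
    (h.frameOperator_sturmEigenvector hY hρ) (h.frameOperator_sturmEigenvector hY hσ)
    fun heq => hne ((pow_left_inj₀ hρ.1.le hσ.1.le two_ne_zero).1 (inv_injective heq))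

theorem mem_span_sturmEigenvector (h : IsGreenFeature q L u v e) (hY : IsSturmFamily q w a Y)
    {μ : ℝ} (hμ : μ ≠ 0) {f : V} (hf : frameOperator 0 L w e f = μ • f) :
    f ∈ Submodule.span ℝ (sturmEigenvector L w Y e '' sturmZeros L Y) := by
  obtain rfl | hf0 := eq_or_ne f 0
  · exact Submodule.zero_mem _
  have hw := hY.continuous_weight
  have he := h.continuous
  have hμpos : 0 < μ := (eigenvalue_nonneg_of_frameOperator_eq_smul hw
    (fun z => (hY.weight_pos z).le) he h.length_pos.le hf0 hf).lt_of_ne' hμ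
  have hmul : μ • f = ∫ z in (0 : ℝ)..L, (w z * ⟪e z, f⟫) • e z := by
    rw [← hf, frameOperator_apply hw he]
  have hgreen x (hx : x ∈ Icc 0 L) :
      μ * ⟪e x, f⟫ = greenIntegral u v L (fun z => w z * ⟪e z, f⟫) x := by
    rw [← real_inner_smul_right, hmul, h.inner_integral (by fun_prop) hx]
  obtain ⟨α, hα⟩ := hY.exists_eq_mul_of_eigenfunction h.toIsDirichletPair (by fun_prop) hμpos hgreen
  set ρ := (√μ)⁻¹
  have hf_eq : f = (μ⁻¹ * α) • sturmEigenvector L w Y e ρ := by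
    rw [eq_comm, ← smul_smul, inv_smul_eq_iff₀ hμ, hmul, sturmEigenvector,
      ← intervalIntegral.integral_smul]
    refine intervalIntegral.integral_congr fun z hz => ?_
    rw [uIcc_of_le h.length_pos.le] at hz
    simp only [hα z hz, smul_smul, mul_left_comm]
  have hYL : Y ρ L = 0 := by
    have hL := right_mem_Icc.2 h.length_pos.le
    have hαne : α ≠ 0 := by
      rintro rfl
      exact hf0 (by rw [hf_eq, mul_zero, zero_smul])
    simpa [hα L hL, h.greenIntegral_length, hμ, hαne] using hgreen L hL
  rw [hf_eq]
  exact Submodule.smul_mem _ _ (Submodule.subset_span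
    (mem_image_of_mem _ ⟨inv_pos.2 (Real.sqrt_pos.2 hμpos), hYL⟩))

theorem mem_closure_span_sturmEigenvector (h : IsGreenFeature q L u v e)
    (hY : IsSturmFamily q w a Y) {s : ℝ} (hs : s ∈ Icc 0 L) :
    e s ∈ (Submodule.span ℝ (sturmEigenvector L w Y e '' sturmZeros L Y)).topologicalClosure :=
  mem_topologicalClosure_of_frameOperator_eigenvectors hY.continuous_weight hY.weight_pos
    h.continuous h.length_pos (fun _ hμ _ hf => h.mem_span_sturmEigenvector hY hμ hf) hs

theorem summable_inv_sq_sturmZeros (h : IsGreenFeature q L u v e) (hY : IsSturmFamily q w a Y) :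
    Summable fun ρ : sturmZeros L Y => ((ρ : ℝ) ^ 2)⁻¹ :=
  summable_of_sum_le (fun _ => inv_nonneg.2 (sq_nonneg _)) <|
    sum_eigenvalues_frameOperator_le hY.continuous_weight (fun z => (hY.weight_pos z).le)
      h.continuous h.length_pos.le
      (fun ρ σ hne => h.inner_sturmEigenvector_eq_zero hY ρ.2 σ.2 (Subtype.coe_injective.ne hne))
      (fun ρ => h.sturmEigenvector_ne_zero hY ρ.2)
      fun ρ => h.frameOperator_sturmEigenvector hY ρ.2

theorem finite_sturmZeros_inter_Iic (h : IsGreenFeature q L u v e) (hY : IsSturmFamily q w a Y)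
    (R : ℝ) : (sturmZeros L Y ∩ Iic R).Finite := by
  have hlarge : ∀ᶠ ρ : sturmZeros L Y in cofinite, ((ρ : ℝ) ^ 2)⁻¹ < (max R 1 ^ 2)⁻¹ :=
    (h.summable_inv_sq_sturmZeros hY).tendsto_cofinite_zero.eventually_lt_const (by positivity)
  refine (hlarge.image Subtype.val).subset fun ρ hρ => ⟨⟨ρ, hρ.1⟩, ?_, rfl⟩
  have hpos : 0 < ρ := hρ.1.1
  exact not_lt.2 (inv_anti₀ (pow_pos hpos 2)
    (pow_le_pow_left₀ hpos.le (hρ.2.trans (le_max_left R 1)) 2))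

theorem differentiableOn_inner_of_mem_span (h : IsGreenFeature q L u v e)
    (hY : IsSturmFamily q w a Y) {f : V}
    (hf : f ∈ Submodule.span ℝ (sturmEigenvector L w Y e '' sturmZeros L Y)) :
    DifferentiableOn ℝ (fun x => ⟪e x, f⟫) (Icc 0 L) := by
  induction hf using Submodule.span_induction with
  | mem f hf =>
    obtain ⟨ρ, hρ, rfl⟩ := hf
    exact ((hY.isShootingSolution ρ hρ.1).differentiable.differentiableOn.div_const _).congr
      fun x hx => h.inner_sturmEigenvector hY hρ hx
  | zero => simp
  | add f g _ _ hf hg => simpa only [inner_add_right] using hf.fun_add hg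
  | smul c f _ hf => simpa only [real_inner_smul_right] using hf.const_mul c

/-- Otherwise every `e s` would be a finite combination of eigenvectors, and the Green function
would be differentiable across the diagonal. -/
theorem infinite_sturmZeros (h : IsGreenFeature q L u v e) (hY : IsSturmFamily q w a Y) :
    (sturmZeros L Y).Infinite := by
  intro hfin
  have : FiniteDimensional ℝ (Submodule.span ℝ (sturmEigenvector L w Y e '' sturmZeros L Y)) :=
    .span_of_finite ℝ (hfin.image _)
  obtain ⟨s, hs⟩ := nonempty_Ioo.2 h.length_pos
  have hsI := Ioo_subset_Icc_self hs
  have hmem := h.mem_closure_span_sturmEigenvector hY hsI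
  rw [(Submodule.closed_of_finiteDimensional _).submodule_topologicalClosure_eq] at hmem
  have hdiff : DifferentiableOn ℝ (fun x => greenKernel u v x s) (Icc 0 L) :=
    (h.differentiableOn_inner_of_mem_span hY hmem).congr fun x hx => (h.inner_eq x hx s hsI).symm
  exact h.not_differentiableAt_greenKernel s (hdiff.differentiableAt (Icc_mem_nhds hs.1 hs.2))

theorem hasSumUniformlyOn_sturm (h : IsGreenFeature q L u v e) (hY : IsSturmFamily q w a Y)
    {ι : Type*} {r : ι → ℝ} (hr : r.Injective) (hrange : range r = sturmZeros L Y) {s : ℝ}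
    (hs : s ∈ Icc 0 L) :
    HasSumUniformlyOn
      (fun i t => Y (r i) s * Y (r i) t / (r i ^ 2 * ∫ z in (0 : ℝ)..L, w z * Y (r i) z ^ 2))
      (fun t => greenKernel u v t s) (Icc 0 L) := by
  have hmem i : r i ∈ sturmZeros L Y := hrange ▸ mem_range_self i
  obtain ⟨C, hC⟩ := isCompact_Icc.exists_bound_of_continuousOn (s := Icc 0 L)
    h.continuous.continuousOn
  have hsum := hasSum_of_mem_closure_span (v := fun i => sturmEigenvector L w Y e (r i)) (x := e s)
    (fun i j hij => h.inner_sturmEigenvector_eq_zero hY (hmem i) (hmem j) (hr.ne hij)) <| by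
      rw [range_comp' (sturmEigenvector L w Y e) r, hrange]
      exact h.mem_closure_span_sturmEigenvector hY hs
  rw [hasSumUniformlyOn_iff_tendstoUniformlyOn]
  refine ((tendstoUniformlyOn_inner hC hsum).congr_right fun t ht => h.inner_eq t ht s hs).congr
    (.of_forall fun T t ht => ?_)
  simp only [inner_sum, real_inner_smul_right, real_inner_comm (e s)]
  refine Finset.sum_congr rfl fun i _ => ?_
  rw [h.inner_sturmEigenvector hY (hmem i) hs, h.inner_sturmEigenvector hY (hmem i) ht,
    h.inner_sturmEigenvector_self hY (hmem i)]
  have hpos := hY.integral_sq_pos h.length_pos (hmem i).1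
  have hri := (hmem i).1
  field_simp

end IsGreenFeature

end Expansion

/-! ### Enumeration of a locally finite set -/

section Enumeration

variable {α : Type*} [ConditionallyCompleteLinearOrder α]

theorem isLeast_sInf_inter_Ioi {S : Set α} (hinf : S.Infinite) (hfin : ∀ R, (S ∩ Iic R).Finite)
    (R : α) : IsLeast (S ∩ Ioi R) (sInf (S ∩ Ioi R)) := by
  obtain ⟨ρ₀, hρ₀, hRρ₀⟩ : (S ∩ Ioi R).Nonempty := by
    rw [← compl_Iic, ← sdiff_eq, ← sdiff_self_inter]
    exact (hinf.sdiff (hfin R)).nonempty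
  obtain ⟨x, ⟨⟨hxS, hRx⟩, hxρ₀⟩, hmin⟩ := exists_min_image (S ∩ Ioi R ∩ Iic ρ₀) id
    ((hfin ρ₀).subset (inter_subset_inter_left _ inter_subset_left)) ⟨ρ₀, ⟨hρ₀, hRρ₀⟩, le_rfl⟩
  have hleast : IsLeast (S ∩ Ioi R) x := by
    refine ⟨⟨hxS, hRx⟩, fun ρ hρ => ?_⟩
    obtain hle | hle := le_total ρ ρ₀
    · exact hmin ρ ⟨hρ, hle⟩
    · exact hxρ₀.trans hle
  rwa [hleast.csInf_eq]

theorem mem_range_of_isLeast {S : Set α} {c : ℕ → α} (hfin : ∀ R, (S ∩ Iic R).Finite)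
    (hc : ∀ m, IsLeast (S ∩ Ioi (c m)) (c (m + 1))) {ρ : α} (hρ : ρ ∈ S) (h0 : c 0 < ρ) :
    ρ ∈ range fun m => c (m + 1) := by
  by_contra hmem
  have hlt m : c m < ρ := by
    induction m with
    | zero => exact h0
    | succ m ih => exact ((hc m).2 ⟨hρ, ih⟩).lt_of_ne fun heq => hmem ⟨m, heq⟩
  have hmono : StrictMono c := strictMono_nat_of_lt_succ fun m => (hc m).1.2
  exact infinite_of_injective_forall_mem (hmono.injective.comp (add_left_injective 1))
    (fun m => (⟨(hc m).1.1, (hlt (m + 1)).le⟩ : c (m + 1) ∈ S ∩ Iic ρ)) (hfin ρ)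

theorem strictMono_and_image_eq_of_sInf {p : α → Prop} {c : ℕ → α}
    (hinf : {ρ | c 0 < ρ ∧ p ρ}.Infinite) (hfin : ∀ R, ({ρ | c 0 < ρ ∧ p ρ} ∩ Iic R).Finite)
    (hc : ∀ m, c (m + 1) = sInf {ρ | c m < ρ ∧ p ρ}) :
    StrictMono c ∧ c '' Ici 1 = {ρ | c 0 < ρ ∧ p ρ} := by
  set S := {ρ | c 0 < ρ ∧ p ρ}
  have hnext m (hm : c 0 ≤ c m) : IsLeast (S ∩ Ioi (c m)) (c (m + 1)) := by
    have hset : {ρ | c m < ρ ∧ p ρ} = S ∩ Ioi (c m) :=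
      Subset.antisymm (fun ρ hρ => ⟨⟨hm.trans_lt hρ.1, hρ.2⟩, hρ.1⟩) fun ρ hρ => ⟨hρ.2, hρ.1.2⟩
    rw [hc, hset]
    exact isLeast_sInf_inter_Ioi hinf hfin _
  have hstart m : c 0 ≤ c m := by
    induction m with
    | zero => exact le_rfl
    | succ m ih => exact (hnext m ih).1.1.1.le
  have hleast m := hnext m (hstart m)
  refine ⟨strictMono_nat_of_lt_succ fun m => (hleast m).1.2, Subset.antisymm ?_ fun ρ hρ => ?_⟩
  · rintro _ ⟨m, hm, rfl⟩
    obtain ⟨k, rfl⟩ := Nat.exists_eq_add_of_le' hm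
    exact (hleast k).1.1
  · obtain ⟨m, rfl⟩ := mem_range_of_isLeast hfin hleast hρ hρ.1
    exact ⟨m + 1, Nat.succ_pos m, rfl⟩

end Enumeration

/-! ### Bessel functions -/

section PowerSeries

variable {a : ℕ → ℝ} {C : ℝ}

theorem summable_mul_pow_div_factorial (ha : ∀ k, |a k| ≤ C) (w : ℝ) :
    Summable fun k => a k * (w ^ k / k.factorial) :=
  .of_norm_bounded ((Real.summable_pow_div_factorial w).norm.mul_left C) fun k => by
    rw [norm_mul]
    exact mul_le_mul_of_nonneg_right (ha k) (norm_nonneg _)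

theorem hasDerivAt_tsum_mul_pow_div_factorial (ha : ∀ k, |a k| ≤ C) (w : ℝ) :
    HasDerivAt (fun w => ∑' k, a k * (w ^ k / k.factorial))
      (∑' k, a (k + 1) * (w ^ k / k.factorial)) w := by
  have hterm (k : ℕ) (y : ℝ) :
      HasDerivAt (fun y => a (k + 1) * (y ^ (k + 1) / (k + 1).factorial))
        (a (k + 1) * (y ^ k / k.factorial)) y := by
    refine (((hasDerivAt_pow (k + 1) y).div_const _).const_mul (a (k + 1))).congr_deriv ?_
    rw [Nat.factorial_succ, Nat.cast_mul, add_tsub_cancel_right,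
      mul_div_mul_left _ _ (Nat.cast_ne_zero.2 k.succ_ne_zero)]
  have hR : w ∈ Metric.ball (0 : ℝ) (|w| + 1) := by simp
  have htail := hasDerivAt_tsum_of_isPreconnected
    ((Real.summable_pow_div_factorial (|w| + 1)).mul_left C) Metric.isOpen_ball
    (convex_ball (0 : ℝ) (|w| + 1)).isPreconnected (fun k y _ => hterm k y) (fun k y hy => ?_) hR
    ((summable_nat_add_iff 1).2 (summable_mul_pow_div_factorial ha w)) hR
  · refine (htail.const_add (a 0)).congr_of_eventuallyEq (.of_forall fun y => ?_)
    simpa using (summable_mul_pow_div_factorial ha y).tsum_eq_zero_add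
  · have hy : |y| ≤ |w| + 1 := (mem_ball_zero_iff.1 hy).le
    rw [norm_mul, norm_div, norm_pow, Real.norm_natCast]
    exact mul_le_mul (ha _) (by gcongr; exact hy) (by positivity) ((abs_nonneg _).trans (ha 0))

end PowerSeries

/-- Once `‖μ‖ ≤ k`, the functional equation makes `‖Γ(μ + k + 1)⁻¹‖` decrease in `k`. -/
theorem exists_norm_inv_Gamma_add_natCast_le (R : ℝ) :
    ∃ C, ∀ μ : ℂ, ‖μ‖ ≤ R → ∀ k : ℕ, ‖(Complex.Gamma (μ + k + 1))⁻¹‖ ≤ C := by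
  obtain ⟨N, hN⟩ := exists_nat_ge R
  have hcont : Continuous fun p : ℂ × ℕ => (Complex.Gamma (p.1 + p.2 + 1))⁻¹ :=
    Complex.differentiable_one_div_Gamma.continuous.comp
      ((continuous_fst.add (continuous_of_discreteTopology.comp continuous_snd)).add_const 1)
  obtain ⟨C, hC⟩ := ((isCompact_closedBall (0 : ℂ) R).prod
    (finite_Iic N).isCompact).exists_bound_of_continuousOn hcont.continuousOn
  refine ⟨C, fun μ hμ k => ?_⟩
  have hsmall k (hk : k ≤ N) := hC (μ, k) ⟨mem_closedBall_zero_iff.2 hμ, hk⟩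
  obtain hk | hk := le_total k N
  · exact hsmall k hk
  induction k, hk using Nat.le_induction with
  | base => exact hsmall N le_rfl
  | succ k hk ih =>
    refine le_trans ?_ ih
    have hone : 1 ≤ ‖μ + k + 1‖ := by
      have htri := norm_sub_norm_le ((k + 1 : ℕ) : ℂ) (-μ)
      rw [Complex.norm_natCast, norm_neg, sub_neg_eq_add, add_comm _ μ, Nat.cast_succ,
        Nat.cast_succ, ← add_assoc] at htri
      have : (N : ℝ) ≤ k := Nat.cast_le.2 hk
      linarith
    have hfun := Complex.one_div_Gamma_eq_self_mul_one_div_Gamma_add_one (μ + k + 1)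
    rw [Nat.cast_succ, ← add_assoc, hfun, norm_mul]
    exact le_mul_of_one_le_left (norm_nonneg _) hone

theorem exists_abs_inv_Gamma_add_natCast_le (ν : ℝ) :
    ∃ C, ∀ k : ℕ, |(Real.Gamma (ν + k + 1))⁻¹| ≤ C := by
  obtain ⟨C, hC⟩ := exists_norm_inv_Gamma_add_natCast_le |ν|
  refine ⟨C, fun k => ?_⟩
  have hle := hC ν (Complex.norm_real ν).le k
  rwa [show (ν : ℂ) + k + 1 = (ν + k + 1 : ℝ) by push_cast; rfl, Complex.Gamma_ofReal,
    ← Complex.ofReal_inv, Complex.norm_real] at hle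

theorem inv_Gamma_eq_mul_inv_Gamma_add_one (x : ℝ) :
    (Real.Gamma x)⁻¹ = x * (Real.Gamma (x + 1))⁻¹ := by
  have hfun := Complex.one_div_Gamma_eq_self_mul_one_div_Gamma_add_one x
  rw [← Complex.ofReal_one, ← Complex.ofReal_add, Complex.Gamma_ofReal, Complex.Gamma_ofReal]
    at hfun
  exact_mod_cast hfun

/-- The Bessel-Clifford function `∑ w ^ k / (k! Γ(ν + k + 1))`, an entire function of `w` and `ν`
with `J_ν(x) = (x / 2) ^ ν * besselClifford ν (-x ^ 2 / 4)`. -/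
noncomputable def besselClifford (ν w : ℝ) : ℝ :=
  ∑' k : ℕ, (Real.Gamma (ν + k + 1))⁻¹ * (w ^ k / k.factorial)

theorem summable_besselClifford (ν w : ℝ) :
    Summable fun k : ℕ => (Real.Gamma (ν + k + 1))⁻¹ * (w ^ k / k.factorial) :=
  have ⟨_, hC⟩ := exists_abs_inv_Gamma_add_natCast_le ν
  summable_mul_pow_div_factorial hC w

theorem hasDerivAt_besselClifford (ν w : ℝ) :
    HasDerivAt (besselClifford ν) (besselClifford (ν + 1) w) w := by
  obtain ⟨C, hC⟩ := exists_abs_inv_Gamma_add_natCast_le ν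
  refine (hasDerivAt_tsum_mul_pow_div_factorial hC w).congr_deriv (tsum_congr fun k => ?_)
  rw [Nat.cast_succ, add_comm (k : ℝ), ← add_assoc]

theorem besselClifford_zero (ν : ℝ) : besselClifford ν 0 = (Real.Gamma (ν + 1))⁻¹ := by
  rw [besselClifford, tsum_eq_single 0 fun k hk => by simp [hk]]
  simp

theorem mul_besselClifford_add_two (ν w : ℝ) :
    w * besselClifford (ν + 2) w = besselClifford ν w - (ν + 1) * besselClifford (ν + 1) w := by
  have hsub := (summable_besselClifford ν w).hasSum.sub
    ((summable_besselClifford (ν + 1) w).hasSum.mul_left (ν + 1))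
  have hcoeff (k : ℕ) : (Real.Gamma (ν + k + 1))⁻¹ * (w ^ k / k.factorial) -
      (ν + 1) * ((Real.Gamma (ν + 1 + k + 1))⁻¹ * (w ^ k / k.factorial)) =
      k * (Real.Gamma (ν + k + 2))⁻¹ * (w ^ k / k.factorial) := by
    rw [inv_Gamma_eq_mul_inv_Gamma_add_one, show ν + 1 + k + 1 = ν + k + 2 by ring,
      show ν + k + 1 + 1 = ν + k + 2 by ring]
    ring
  simp only [hcoeff] at hsub
  refine Eq.trans ?_ hsub.tsum_eq
  rw [besselClifford, hsub.summable.tsum_eq_zero_add, Nat.cast_zero, zero_mul, zero_mul, zero_add,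
    ← tsum_mul_left]
  refine tsum_congr fun k => ?_
  rw [Nat.factorial_succ, Nat.cast_mul, Nat.cast_succ,
    show ν + 2 + (k : ℝ) + 1 = ν + (k + 1) + 2 by ring, pow_succ']
  field_simp

theorem besselClifford_neg_natCast (n : ℕ) (w : ℝ) :
    besselClifford (-n) w = w ^ n * besselClifford n w := by
  have hpole : ∑ k ∈ Finset.range n,
      (Real.Gamma (-(n : ℝ) + k + 1))⁻¹ * (w ^ k / k.factorial) = 0 := by
    refine Finset.sum_eq_zero fun k hk => ?_
    obtain ⟨j, rfl⟩ := Nat.exists_eq_add_of_lt (Finset.mem_range.1 hk)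
    rw [show -((k + j + 1 : ℕ) : ℝ) + k + 1 = -(j : ℝ) by push_cast; ring,
      Real.Gamma_neg_nat_eq_zero, inv_zero, zero_mul]
  rw [besselClifford, besselClifford, ← (summable_besselClifford (-n) w).sum_add_tsum_nat_add n,
    hpole, zero_add, ← tsum_mul_left]
  refine tsum_congr fun k => ?_
  rw [show -(n : ℝ) + ((k + n : ℕ) : ℝ) + 1 = k + 1 by push_cast; ring,
    show (n : ℝ) + k + 1 = ((k + n : ℕ) : ℝ) + 1 by push_cast; ring, Real.Gamma_nat_eq_factorial,
    Real.Gamma_nat_eq_factorial, pow_add]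
  ring

/-- The left-hand side is constant in `w`, and its value at `w = 0` is given by Euler's reflection
formula. -/
theorem besselClifford_wronskian (ν w : ℝ) :
    besselClifford ν w * besselClifford (-ν - 1) w -
      w * (besselClifford (ν + 1) w * besselClifford (-ν) w) =
      -(Real.sin (ν * Real.pi) / Real.pi) := by
  have hderiv z : HasDerivAt (fun w => besselClifford ν w * besselClifford (-ν - 1) w -
      w * (besselClifford (ν + 1) w * besselClifford (-ν) w)) 0 z := by
    refine (((hasDerivAt_besselClifford ν z).mul (hasDerivAt_besselClifford (-ν - 1) z)).sub
      ((hasDerivAt_id z).mul ((hasDerivAt_besselClifford (ν + 1) z).mul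
        (hasDerivAt_besselClifford (-ν) z)))).congr_deriv ?_
    have hplus := mul_besselClifford_add_two ν z
    have hminus := mul_besselClifford_add_two (-ν - 1) z
    rw [sub_add_cancel, show -ν - 1 + 2 = -ν + 1 by ring] at hminus
    rw [sub_add_cancel, show ν + 1 + 1 = ν + 2 by ring]
    simp only [Pi.mul_apply, id_eq]
    linear_combination -besselClifford (-ν) z * hplus - besselClifford (ν + 1) z * hminus
  have hconst := is_const_of_deriv_eq_zero (fun z => (hderiv z).differentiableAt)
    (fun z => (hderiv z).deriv) w 0
  refine hconst.trans ?_
  have hreflect := Real.Gamma_mul_Gamma_one_sub (-ν)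
  rw [sub_neg_eq_add, add_comm, mul_neg, Real.sin_neg, mul_comm Real.pi] at hreflect
  rw [zero_mul, sub_zero, besselClifford_zero, besselClifford_zero, sub_add_cancel, ← mul_inv_rev,
    hreflect, inv_div, neg_div]

theorem differentiable_besselClifford_order (w : ℝ) :
    Differentiable ℝ fun ν => besselClifford ν w := by
  intro ν
  set R := |ν| + 1
  obtain ⟨C, hC⟩ := exists_norm_inv_Gamma_add_natCast_le R
  have hdiff : DifferentiableOn ℂ
      (fun μ : ℂ => ∑' k : ℕ, (Complex.Gamma (μ + k + 1))⁻¹ * ((w : ℂ) ^ k / k.factorial))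
      (Metric.ball 0 R) := by
    refine Complex.differentiableOn_tsum_of_summable_norm
      ((Real.summable_pow_div_factorial |w|).mul_left C) (fun k => ?_) Metric.isOpen_ball
      fun k μ hμ => ?_
    · exact ((Complex.differentiable_one_div_Gamma.comp
        ((differentiable_id.add_const (k : ℂ)).add_const 1)).mul_const _).differentiableOn
    · rw [norm_mul, norm_div, norm_pow, Complex.norm_real, Complex.norm_natCast, Real.norm_eq_abs]
      exact mul_le_mul_of_nonneg_right (hC μ (mem_ball_zero_iff.1 hμ).le k) (by positivity)
  have hν : (ν : ℂ) ∈ Metric.ball (0 : ℂ) R := by simp [R]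
  have hreal (x : ℝ) : besselClifford x w = (∑' k : ℕ,
      (Complex.Gamma ((x : ℂ) + k + 1))⁻¹ * ((w : ℂ) ^ k / k.factorial)).re := by
    rw [← Complex.ofReal_re (besselClifford x w), besselClifford, Complex.ofReal_tsum]
    refine congrArg Complex.re (tsum_congr fun k => ?_)
    rw [show (x : ℂ) + k + 1 = (x + k + 1 : ℝ) by push_cast; rfl, Complex.Gamma_ofReal]
    push_cast
    rfl
  simp only [hreal]
  exact (hdiff.differentiableAt (Metric.isOpen_ball.mem_nhds hν)).hasDerivAt.real_of_complex
    |>.differentiableAt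

theorem besselJ_eq_rpow_mul_besselClifford (ν : ℝ) {x : ℝ} (hx : 0 < x) :
    besselJ ν x = (x / 2) ^ ν * besselClifford ν (-(x / 2) ^ 2) := by
  rw [besselJ, besselClifford, ← tsum_mul_left]
  refine tsum_congr fun k => ?_
  rw [Real.rpow_add (half_pos hx), Real.rpow_mul (half_pos hx).le, Real.rpow_two,
    Real.rpow_natCast, neg_pow ((x / 2) ^ 2)]
  ring

theorem differentiable_besselJ_order {x : ℝ} (hx : 0 < x) :
    Differentiable ℝ fun ν => besselJ ν x := by
  simp only [besselJ_eq_rpow_mul_besselClifford _ hx]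
  exact fun ν => (Real.hasStrictDerivAt_const_rpow (half_pos hx) ν).hasDerivAt.differentiableAt.mul
    (differentiable_besselClifford_order _ ν)

theorem besselJ_add_two (ν : ℝ) {x : ℝ} (hx : 0 < x) :
    besselJ (ν + 2) x = 2 * (ν + 1) / x * besselJ (ν + 1) x - besselJ ν x := by
  have hx2 := half_pos hx
  simp only [besselJ_eq_rpow_mul_besselClifford _ hx, Real.rpow_add hx2, Real.rpow_two,
    Real.rpow_one]
  have hrec := mul_besselClifford_add_two ν (-(x / 2) ^ 2)
  rw [div_pow] at hrec
  field_simp at hrec ⊢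
  linear_combination (-1) * hrec

theorem hasDerivAt_besselJ (ν : ℝ) {x : ℝ} (hx : 0 < x) :
    HasDerivAt (besselJ ν) (ν / x * besselJ ν x - besselJ (ν + 1) x) x := by
  have hx2 := half_pos hx
  have hbase : HasDerivAt (fun x : ℝ => x / 2) (1 / 2) x := (hasDerivAt_id x).div_const 2
  have hprod := (hbase.rpow_const (p := ν) (.inl hx2.ne')).mul
    ((hasDerivAt_besselClifford ν _).comp x (hbase.pow 2).neg)
  refine (hprod.congr_of_eventuallyEq ?_).congr_deriv ?_
  · filter_upwards [eventually_gt_nhds hx] with y hy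
    exact besselJ_eq_rpow_mul_besselClifford ν hy
  · simp only [besselJ_eq_rpow_mul_besselClifford _ hx, Real.rpow_add_one hx2.ne',
      Real.rpow_sub_one hx2.ne', Function.comp_apply, Pi.neg_apply, Pi.pow_apply]
    field_simp
    ring

theorem hasDerivAt_mul_deriv_besselJ (ν : ℝ) {x : ℝ} (hx : 0 < x) :
    HasDerivAt (fun x => x * deriv (besselJ ν) x) ((ν ^ 2 / x - x) * besselJ ν x) x := by
  have heq : (fun x => x * deriv (besselJ ν) x) =ᶠ[𝓝 x]
      fun x => ν * besselJ ν x - x * besselJ (ν + 1) x := by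
    filter_upwards [eventually_gt_nhds hx] with y hy
    rw [(hasDerivAt_besselJ ν hy).deriv]
    field_simp
  refine ((((hasDerivAt_besselJ ν hx).const_mul ν).sub ((hasDerivAt_id x).mul
    (hasDerivAt_besselJ (ν + 1) hx))).congr_of_eventuallyEq heq).congr_deriv ?_
  rw [show ν + 1 + 1 = ν + 2 by ring, besselJ_add_two ν hx]
  simp only [id_eq]
  field_simp
  ring

theorem besselJ_wronskian (ν : ℝ) {x : ℝ} (hx : 0 < x) :
    x * (deriv (besselJ ν) x * besselJ (-ν) x - besselJ ν x * deriv (besselJ (-ν)) x) =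
      2 * Real.sin (ν * Real.pi) / Real.pi := by
  have hx2 := half_pos hx
  have hrec := besselJ_add_two (-ν - 1) hx
  rw [show -ν - 1 + 2 = -ν + 1 by ring, sub_add_cancel] at hrec
  have hprod : x * (besselJ (ν + 1) x * besselJ (-ν) x + besselJ ν x * besselJ (-ν - 1) x) =
      -(2 * Real.sin (ν * Real.pi) / Real.pi) := by
    have hW := besselClifford_wronskian ν (-(x / 2) ^ 2)
    simp only [besselJ_eq_rpow_mul_besselClifford _ hx, Real.rpow_add_one hx2.ne',
      Real.rpow_sub_one hx2.ne', Real.rpow_neg hx2.le]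
    field_simp at hW ⊢
    linear_combination hW
  rw [(hasDerivAt_besselJ ν hx).deriv, (hasDerivAt_besselJ (-ν) hx).deriv, hrec]
  field_simp at hprod ⊢
  linear_combination -hprod

theorem besselJ_neg_natCast (n : ℕ) {x : ℝ} (hx : 0 < x) :
    besselJ (-n) x = (-1) ^ n * besselJ n x := by
  rw [besselJ_eq_rpow_mul_besselClifford _ hx, besselJ_eq_rpow_mul_besselClifford _ hx,
    besselClifford_neg_natCast, Real.rpow_neg (half_pos hx).le, Real.rpow_natCast,
    neg_pow ((x / 2) ^ 2), pow_right_comm, sq]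
  field_simp

theorem besselJ_neg_intCast (n : ℤ) {x : ℝ} (hx : 0 < x) :
    besselJ (-n) x = besselJ n x * Real.cos (n * Real.pi) := by
  obtain ⟨m, rfl | rfl⟩ := n.eq_nat_or_neg
  · rw [Int.cast_natCast, Real.cos_nat_mul_pi, besselJ_neg_natCast m hx, mul_comm]
  · rw [Int.cast_neg, Int.cast_natCast, neg_neg, neg_mul, Real.cos_neg, Real.cos_nat_mul_pi,
      besselJ_neg_natCast m hx, mul_right_comm, ← mul_pow, neg_one_mul, neg_neg, one_pow, one_mul]

theorem besselY_of_sin_ne_zero {ν : ℝ} (hν : Real.sin (ν * Real.pi) ≠ 0) (x : ℝ) :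
    besselY ν x = besselYQuotient ν x :=
  if_neg fun ⟨n, hn⟩ => hν (hn ▸ Real.sin_int_mul_pi n)

theorem hasDerivAt_sin_mul_pi (ν : ℝ) :
    HasDerivAt (fun μ => Real.sin (μ * Real.pi)) (Real.cos (ν * Real.pi) * Real.pi) ν :=
  ((hasDerivAt_id ν).mul_const Real.pi).sin.congr_deriv (by rw [one_mul, id_eq])

theorem cos_int_mul_pi_ne_zero (n : ℤ) : Real.cos (n * Real.pi) ≠ 0 := by
  rw [Real.cos_int_mul_pi]
  exact zpow_ne_zero n (neg_ne_zero.2 one_ne_zero)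

theorem eventually_sin_mul_pi_ne_zero (n : ℤ) : ∀ᶠ μ in 𝓝[≠] (n : ℝ), Real.sin (μ * Real.pi) ≠ 0 :=
  (hasDerivAt_sin_mul_pi n).eventually_ne (mul_ne_zero (cos_int_mul_pi_ne_zero n) Real.pi_ne_zero)

theorem tendsto_div_of_hasDerivAt {f g : ℝ → ℝ} {f' g' a : ℝ} (hf : HasDerivAt f f' a)
    (hg : HasDerivAt g g' a) (hfa : f a = 0) (hga : g a = 0) (hg' : g' ≠ 0) :
    Tendsto (fun x => f x / g x) (𝓝[≠] a) (𝓝 (f' / g')) := by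
  refine (hf.tendsto_slope.div hg.tendsto_slope hg').congr' ?_
  filter_upwards [self_mem_nhdsWithin] with x hx
  rw [Pi.div_apply, slope_def_field, slope_def_field, hfa, hga, sub_zero, sub_zero,
    div_div_div_cancel_right₀ (sub_ne_zero.2 hx)]

theorem tendsto_besselY_order (n : ℤ) {x : ℝ} (hx : 0 < x) :
    Tendsto (fun μ => besselY μ x) (𝓝[≠] (n : ℝ)) (𝓝 (besselY n x)) := by
  have hJ := differentiable_besselJ_order hx
  have hnum : DifferentiableAt ℝ
      (fun μ => besselJ μ x * Real.cos (μ * Real.pi) - besselJ (-μ) x) n :=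
    ((hJ n).mul (by fun_prop)).sub (hJ.comp differentiable_neg n)
  have hlim := tendsto_div_of_hasDerivAt hnum.hasDerivAt (hasDerivAt_sin_mul_pi n)
    (sub_eq_zero.2 (besselJ_neg_intCast n hx).symm) (Real.sin_int_mul_pi n)
    (mul_ne_zero (cos_int_mul_pi_ne_zero n) Real.pi_ne_zero)
  rw [besselY, if_pos ⟨n, rfl⟩]
  refine (tendsto_nhds_limUnder ⟨_, hlim⟩).congr' ?_
  filter_upwards [eventually_sin_mul_pi_ne_zero n] with μ hμ
  exact (besselY_of_sin_ne_zero hμ x).symm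

theorem tendsto_crossU_order (n : ℤ) {b ρ t : ℝ} (hb : 0 < b) (hρ : 0 < ρ) (ht : 0 < t) :
    Tendsto (fun μ => crossU b μ ρ t) (𝓝[≠] (n : ℝ)) (𝓝 (crossU b n ρ t)) := by
  have hJ {x : ℝ} (hx : 0 < x) : Tendsto (fun μ => besselJ μ x) (𝓝[≠] (n : ℝ))
      (𝓝 (besselJ n x)) :=
    ((differentiable_besselJ_order hx).continuous.tendsto n).mono_left nhdsWithin_le_nhds
  have hρb := mul_pos hρ hb
  have hρt := mul_pos hρ ht
  exact ((hJ hρt).mul (tendsto_besselY_order n hρb)).sub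
    ((hJ hρb).mul (tendsto_besselY_order n hρt))

theorem crossU_of_sin_ne_zero {ν : ℝ} (hν : Real.sin (ν * Real.pi) ≠ 0) (b ρ t : ℝ) :
    crossU b ν ρ t = besselJ ν (ρ * b) / Real.sin (ν * Real.pi) * besselJ (-ν) (ρ * t) -
      besselJ (-ν) (ρ * b) / Real.sin (ν * Real.pi) * besselJ ν (ρ * t) := by
  simp only [crossU, besselY_of_sin_ne_zero hν, besselYQuotient]
  ring

/-! ### The cross product in the logarithmic variable -/

theorem hasDerivAt_mul_exp_neg (c z : ℝ) :
    HasDerivAt (fun z => c * Real.exp (-z)) (-(c * Real.exp (-z))) z :=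
  ((hasDerivAt_neg z).exp.const_mul c).congr_deriv (by ring)

theorem hasDerivAt_besselJ_mul_exp_neg (ν : ℝ) {c : ℝ} (hc : 0 < c) (z : ℝ) :
    HasDerivAt (fun z => besselJ ν (c * Real.exp (-z)))
      (-(c * Real.exp (-z) * deriv (besselJ ν) (c * Real.exp (-z)))) z :=
  ((hasDerivAt_besselJ ν (by positivity)).differentiableAt.hasDerivAt.comp z
    (hasDerivAt_mul_exp_neg c z)).congr_deriv (by ring)

theorem isSolution_besselJ_mul_exp_neg (ν : ℝ) {c : ℝ} (hc : 0 < c) :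
    IsSolution (fun z => ν ^ 2 - (c * Real.exp (-z)) ^ 2)
      fun z => besselJ ν (c * Real.exp (-z)) := by
  refine .of_hasDerivAt (hasDerivAt_besselJ_mul_exp_neg ν hc) fun z => ?_
  have hx : 0 < c * Real.exp (-z) := by positivity
  refine ((hasDerivAt_mul_deriv_besselJ ν hx).comp z
    (hasDerivAt_mul_exp_neg c z)).neg.congr_deriv ?_
  field_simp

theorem isShootingSolution_crossU_of_sin_ne_zero {b ν ρ : ℝ} (hν : Real.sin (ν * Real.pi) ≠ 0)
    (hb : 0 < b) (hρ : 0 < ρ) :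
    IsShootingSolution (fun z => ν ^ 2 - (ρ * b * Real.exp (-z)) ^ 2) (2 / Real.pi)
      fun z => crossU b ν ρ (b * Real.exp (-z)) := by
  have hc := mul_pos hρ hb
  have hneg := isSolution_besselJ_mul_exp_neg (-ν) hc
  rw [neg_sq] at hneg
  simp only [crossU_of_sin_ne_zero hν, ← mul_assoc ρ b]
  refine ⟨(hneg.const_mul _).sub ((isSolution_besselJ_mul_exp_neg ν hc).const_mul _), ?_, ?_⟩
  · simp only [neg_zero, Real.exp_zero, mul_one]
    ring
  · refine (((hasDerivAt_besselJ_mul_exp_neg (-ν) hc 0).const_mul _).sub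
      ((hasDerivAt_besselJ_mul_exp_neg ν hc 0).const_mul _)).deriv.trans ?_
    simp only [neg_zero, Real.exp_zero, mul_one]
    have hW := besselJ_wronskian ν hc
    field_simp at hW ⊢
    linear_combination hW

theorem isShootingSolution_crossU_intCast (n : ℤ) {b ρ : ℝ} (hb : 0 < b) (hρ : 0 < ρ) :
    IsShootingSolution (fun z => (n : ℝ) ^ 2 - (ρ * b * Real.exp (-z)) ^ 2) (2 / Real.pi)
      fun z => crossU b n ρ (b * Real.exp (-z)) := by
  refine .of_tendsto (l := 𝓝[≠] (n : ℝ)) (q := fun μ z => μ ^ 2 - (ρ * b * Real.exp (-z)) ^ 2)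
    (y := fun μ z => crossU b μ ρ (b * Real.exp (-z))) ?_ (fun μ => by fun_prop) (by fun_prop)
    (fun z => ?_) (fun M => ?_) fun z => tendsto_crossU_order n hb hρ (by positivity)
  · filter_upwards [eventually_sin_mul_pi_ne_zero n] with μ hμ
    exact isShootingSolution_crossU_of_sin_ne_zero hμ hb hρ
  · exact tendsto_nhdsWithin_of_tendsto_nhds (Continuous.tendsto (by fun_prop) _)
  · obtain ⟨K, hK⟩ := ((isCompact_closedBall (n : ℝ) 1).prod
      (isCompact_Icc (a := -M) (b := M))).exists_bound_of_continuousOn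
      (f := fun p : ℝ × ℝ => p.1 ^ 2 - (ρ * b * Real.exp (-p.2)) ^ 2) (by fun_prop)
    refine ⟨K, eventually_nhdsWithin_of_eventually_nhds ?_⟩
    filter_upwards [Metric.closedBall_mem_nhds (n : ℝ) one_pos] with μ hμ z hz
    exact hK (μ, z) ⟨hμ, abs_le.1 hz⟩

theorem isShootingSolution_crossU (ν : ℝ) {b ρ : ℝ} (hb : 0 < b) (hρ : 0 < ρ) :
    IsShootingSolution (fun z => ν ^ 2 - (ρ * b * Real.exp (-z)) ^ 2) (2 / Real.pi)
      fun z => crossU b ν ρ (b * Real.exp (-z)) := by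
  by_cases hν : Real.sin (ν * Real.pi) = 0
  · obtain ⟨n, hn⟩ := Real.sin_eq_zero_iff.1 hν
    obtain rfl : (n : ℝ) = ν := mul_right_cancel₀ Real.pi_ne_zero hn
    exact isShootingSolution_crossU_intCast n hb hρ
  · exact isShootingSolution_crossU_of_sin_ne_zero hν hb hρ

theorem isSturmFamily_crossU (ν : ℝ) {b : ℝ} (hb : 0 < b) :
    IsSturmFamily (fun _ => ν ^ 2) (fun z => (b * Real.exp (-z)) ^ 2) (2 / Real.pi)
      fun ρ z => crossU b ν ρ (b * Real.exp (-z)) where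
  continuous_potential := continuous_const
  continuous_weight := by fun_prop
  weight_pos z := by positivity
  slope_ne_zero := by positivity
  isShootingSolution ρ hρ := by
    simpa only [mul_pow, mul_assoc] using isShootingSolution_crossU ν hb hρ

section LogVariable

variable {b : ℝ}

theorem mul_exp_neg_log_div {t : ℝ} (hb : 0 < b) (ht : 0 < t) :
    b * Real.exp (-Real.log (b / t)) = t := by
  rw [Real.exp_neg, Real.exp_log (div_pos hb ht), inv_div, mul_div_cancel₀ _ hb.ne']

theorem mul_exp_neg_log (hb : 0 < b) : b * Real.exp (-Real.log b) = 1 := by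
  rw [Real.exp_neg, Real.exp_log hb, mul_inv_cancel₀ hb.ne']

theorem integral_mul_comp_mul_exp_neg (hb : 1 ≤ b) (g : ℝ → ℝ) :
    ∫ z in (0 : ℝ)..Real.log b, b * Real.exp (-z) * g (b * Real.exp (-z)) =
      ∫ τ in (1 : ℝ)..b, g τ := by
  have hb0 : 0 < b := one_pos.trans_le hb
  have hsubst := intervalIntegral.integral_comp_mul_deriv_of_deriv_nonpos (a := 0)
    (b := Real.log b) (f := fun z => b * Real.exp (-z)) (g := g)
    (Continuous.continuousOn (by fun_prop))
    (fun z _ => hasDerivAt_mul_exp_neg b z)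
    fun z _ => neg_nonpos.2 (by positivity)
  simp only [mul_exp_neg_log hb0, neg_zero, Real.exp_zero, mul_one, Function.comp_apply, mul_neg,
    intervalIntegral.integral_neg] at hsubst
  rw [intervalIntegral.integral_symm b 1, ← hsubst, neg_neg]
  simp only [mul_comm]

theorem integral_weight_mul_crossU_sq (hb : 1 ≤ b) (ν ρ : ℝ) :
    ∫ z in (0 : ℝ)..Real.log b,
      (b * Real.exp (-z)) ^ 2 * crossU b ν ρ (b * Real.exp (-z)) ^ 2 =
      ∫ τ in (1 : ℝ)..b, crossU b ν ρ τ ^ 2 * τ := by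
  rw [← integral_mul_comp_mul_exp_neg hb]
  exact intervalIntegral.integral_congr fun z _ => by ring

theorem sturmZeros_crossU (hb : 0 < b) (ν : ℝ) :
    sturmZeros (Real.log b) (fun ρ z => crossU b ν ρ (b * Real.exp (-z))) =
      {ρ | 0 < ρ ∧ crossU b ν ρ 1 = 0} := by
  simp only [sturmZeros, mul_exp_neg_log hb]

theorem isDirichletPair_sinh {ν L : ℝ} (hν : ν ≠ 0) (hL : 0 < L) :
    IsDirichletPair (fun _ => ν ^ 2) L (fun z => Real.sinh (ν * z) / ν)
      fun z => Real.sinh (ν * (L - z)) / Real.sinh (ν * L) := by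
  have hleft z : HasDerivAt (fun z => Real.sinh (ν * z) / ν) (Real.cosh (ν * z)) z :=
    (((hasDerivAt_id z).const_mul ν).sinh.div_const ν).congr_deriv (by simp [hν])
  have hinner z : HasDerivAt (fun z => ν * (L - z)) (-ν) z :=
    (((hasDerivAt_id z).const_sub L).const_mul ν).congr_deriv (by ring)
  have hsinh {x : ℝ} (hx : 0 < x) : 0 < Real.sinh (ν * x) / Real.sinh (ν * L) := by
    obtain hν | hν := hν.lt_or_gt
    · exact div_pos_of_neg_of_neg (Real.sinh_neg_iff.2 (mul_neg_of_neg_of_pos hν hx))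
        (Real.sinh_neg_iff.2 (mul_neg_of_neg_of_pos hν hL))
    · exact div_pos (Real.sinh_pos_iff.2 (mul_pos hν hx)) (Real.sinh_pos_iff.2 (mul_pos hν hL))
  refine ⟨hL, .of_hasDerivAt hleft fun z => ?_, .of_hasDerivAt
    (fun z => (hinner z).sinh.div_const _) fun z => ?_, ?_, ?_, ?_, fun x hx => ?_⟩
  · exact ((hasDerivAt_id z).const_mul ν).cosh.congr_deriv (by simp; field_simp)
  · exact (((hinner z).cosh.mul_const _).div_const _).congr_deriv (by ring)
  · simp
  · simp
  · have hne : Real.sinh (ν * L) ≠ 0 := Real.sinh_ne_zero.2 (mul_ne_zero hν hL.ne')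
    simp [(hleft 0).deriv, hne]
  · exact hsinh (sub_pos.2 hx.2)

theorem isDirichletPair_linear {L : ℝ} (hL : 0 < L) :
    IsDirichletPair (fun _ => 0) L (fun z => z) fun z => (L - z) / L := by
  have hright z : HasDerivAt (fun z => (L - z) / L) (-1 / L) z :=
    ((hasDerivAt_id z).const_sub L).div_const L
  refine ⟨hL, .of_hasDerivAt hasDerivAt_id fun z => ?_, .of_hasDerivAt hright fun z => ?_, rfl, ?_,
    ?_, fun x hx => div_pos (sub_pos.2 hx.2) hL⟩
  · simpa using hasDerivAt_const z (1 : ℝ)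
  · simpa using hasDerivAt_const z (-1 / L)
  · simp
  · simp [hL.ne']

theorem exists_isDirichletPair (ν : ℝ) {L : ℝ} (hL : 0 < L) :
    ∃ u v, IsDirichletPair (fun _ => ν ^ 2) L u v := by
  obtain rfl | hν := eq_or_ne ν 0
  · exact ⟨_, _, by simpa using isDirichletPair_linear hL⟩
  · exact ⟨_, _, isDirichletPair_sinh hν hL⟩

theorem crossZero_enumerates (ν : ℝ) (hb : 1 < b) :
    StrictMono (crossZero b ν) ∧
      crossZero b ν '' Ici 1 = {ρ | 0 < ρ ∧ crossU b ν ρ 1 = 0} := by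
  have hb0 := one_pos.trans hb
  obtain ⟨u, v, huv⟩ := exists_isDirichletPair ν (Real.log_pos hb)
  have hzeros := sturmZeros_crossU hb0 ν
  exact strictMono_and_image_eq_of_sInf
    (hzeros ▸ huv.isGreenFeature.infinite_sturmZeros (isSturmFamily_crossU ν hb0))
    (hzeros ▸ huv.isGreenFeature.finite_sturmZeros_inter_Iic (isSturmFamily_crossU ν hb0))
    fun m => rfl

theorem log_div_mem_Icc {t : ℝ} (ht : t ∈ Icc 1 b) : Real.log (b / t) ∈ Icc 0 (Real.log b) := by
  have ht0 : 0 < t := one_pos.trans_le ht.1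
  have hb0 : 0 < b := ht0.trans_le ht.2
  exact ⟨Real.log_nonneg ((one_le_div ht0).2 ht.2),
    Real.log_le_log (div_pos hb0 ht0) (div_le_self hb0.le ht.1)⟩

theorem greenKernel_log_div {s t : ℝ} (u v : ℝ → ℝ) (hb : 0 < b) (hs : 0 < s) (ht : 0 < t) :
    greenKernel u v (Real.log (b / t)) (Real.log (b / s)) =
      if t ≤ s then u (Real.log (b / s)) * v (Real.log (b / t))
      else u (Real.log (b / t)) * v (Real.log (b / s)) := by
  have hiff : Real.log (b / s) ≤ Real.log (b / t) ↔ t ≤ s := by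
    rw [Real.log_le_log_iff (div_pos hb hs) (div_pos hb ht), div_le_div_iff_of_pos_left hb hs ht]
  split_ifs with hts
  · rw [greenKernel, min_eq_right (hiff.2 hts), max_eq_left (hiff.2 hts)]
  · have hlt := (lt_iff_lt_of_le_iff_le hiff).2 (not_le.1 hts)
    rw [greenKernel, min_eq_left hlt.le, max_eq_right hlt.le]

theorem tendstoUniformlyOn_sum_crossTerm {ν s : ℝ} {u v : ℝ → ℝ} (hb : 1 < b) (hs : s ∈ Icc 1 b)
    (huv : IsDirichletPair (fun _ => ν ^ 2) (Real.log b) u v) :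
    TendstoUniformlyOn (fun (M : ℕ) t => ∑ m ∈ Finset.Icc 1 M, crossTerm b ν s t m)
      (fun t => if t ≤ s then u (Real.log (b / s)) * v (Real.log (b / t))
        else u (Real.log (b / t)) * v (Real.log (b / s))) atTop (Icc 1 b) := by
  have hb0 := one_pos.trans hb
  have hpos {t} (ht : t ∈ Icc 1 b) : 0 < t := one_pos.trans_le ht.1
  obtain ⟨hmono, himage⟩ := crossZero_enumerates ν hb
  have hrange : range (fun m => crossZero b ν (m + 1)) =
      sturmZeros (Real.log b) fun ρ z => crossU b ν ρ (b * Real.exp (-z)) := by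
    rw [sturmZeros_crossU hb0, ← himage, show Ici 1 = range Nat.succ from Nat.range_succ.symm,
      ← range_comp]
    rfl
  have hsum := huv.isGreenFeature.hasSumUniformlyOn_sturm (isSturmFamily_crossU ν hb0)
    (hmono.injective.comp (add_left_injective 1)) hrange (log_div_mem_Icc hs)
  refine (((hsum.tendstoUniformlyOn_finsetRange.comp fun t => Real.log (b / t)).mono
    fun t => log_div_mem_Icc).congr ?_).congr_right
    fun t ht => greenKernel_log_div u v hb0 (hpos hs) (hpos ht)
  refine .of_forall fun M t ht => ?_
  simp only [Function.comp_apply, integral_weight_mul_crossU_sq hb.le,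
    mul_exp_neg_log_div hb0 (hpos hs), mul_exp_neg_log_div hb0 (hpos ht)]
  rw [Finset.range_eq_Ico]
  exact Finset.sum_Ico_add' (crossTerm b ν s t) 0 M 1

end LogVariable

theorem sinh_mul_log_eq (ν : ℝ) {t : ℝ} (ht : 0 < t) :
    Real.sinh (ν * Real.log t) = psiFun ν t / 2 := by
  rw [psiFun, Real.rpow_def_of_pos ht, Real.rpow_def_of_pos ht, Real.sinh_eq, mul_neg,
    mul_comm (Real.log t)]

theorem log_sub_log_div {b t : ℝ} (hb : b ≠ 0) (ht : t ≠ 0) :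
    Real.log b - Real.log (b / t) = Real.log t := by
  rw [Real.log_div hb ht, sub_sub_cancel]

theorem tendstoUniformlyOn_two_mul_sum_crossTerm {b s ν : ℝ} (hb : 1 < b) (hs : s ∈ Icc 1 b)
    (hν : ν ≠ 0) :
    TendstoUniformlyOn (fun (M : ℕ) t => 2 * ν * ∑ m ∈ Finset.Icc 1 M, crossTerm b ν s t m)
      (fun t => if t ≤ s then psiFun ν t * psiFun ν (b / s) / psiFun ν b
        else psiFun ν s * psiFun ν (b / t) / psiFun ν b) atTop (Icc 1 b) := by
  have hb0 := one_pos.trans hb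
  have hs0 : 0 < s := one_pos.trans_le hs.1
  have hsum := tendstoUniformlyOn_sum_crossTerm hb hs (isDirichletPair_sinh hν (Real.log_pos hb))
  refine ((uniformContinuous_id.const_mul' (2 * ν)).comp_tendstoUniformlyOn hsum).congr_right
    fun t ht => ?_
  have ht0 : 0 < t := one_pos.trans_le ht.1
  simp only [Function.comp_apply, id_eq, log_sub_log_div hb0.ne' hs0.ne',
    log_sub_log_div hb0.ne' ht0.ne', sinh_mul_log_eq ν hs0, sinh_mul_log_eq ν ht0,
    sinh_mul_log_eq ν hb0, sinh_mul_log_eq ν (div_pos hb0 hs0),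
    sinh_mul_log_eq ν (div_pos hb0 ht0)]
  split_ifs <;> field_simp

theorem tendstoUniformlyOn_sum_crossTerm_zero {b s : ℝ} (hb : 1 < b) (hs : s ∈ Icc 1 b) :
    TendstoUniformlyOn (fun (M : ℕ) t => ∑ m ∈ Finset.Icc 1 M, crossTerm b 0 s t m)
      (fun t => if t ≤ s then Real.log t * Real.log (b / s) / Real.log b
        else Real.log s * Real.log (b / t) / Real.log b) atTop (Icc 1 b) := by
  have hb0 := (one_pos.trans hb).ne'
  have hne {t} (ht : t ∈ Icc 1 b) : t ≠ 0 := (one_pos.trans_le ht.1).ne'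
  have hpair : IsDirichletPair (fun _ => (0 : ℝ) ^ 2) (Real.log b) (fun z => z)
      fun z => (Real.log b - z) / Real.log b := by
    simpa using isDirichletPair_linear (Real.log_pos hb)
  refine (tendstoUniformlyOn_sum_crossTerm hb hs hpair).congr_right fun t ht => ?_
  simp only [log_sub_log_div hb0 (hne hs), log_sub_log_div hb0 (hne ht)]
  split_ifs <;> ring

theorem mainTheorem8_general (b s : ℝ) (hb : 1 < b) (hs : s ∈ Set.Icc 1 b) :
    (∀ ν : ℝ,
      StrictMono (crossZero b ν) ∧
      crossZero b ν '' Set.Ici 1 = {ρ : ℝ | 0 < ρ ∧ crossU b ν ρ 1 = 0}) ∧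
    (∀ ν : ℝ, ν ≠ 0 →
      TendstoUniformlyOn
        (fun (M : ℕ) (t : ℝ) => 2 * ν * ∑ m ∈ Finset.Icc 1 M, crossTerm b ν s t m)
        (fun t : ℝ =>
          if t ≤ s then psiFun ν t * psiFun ν (b / s) / psiFun ν b
          else psiFun ν s * psiFun ν (b / t) / psiFun ν b)
        Filter.atTop (Set.Icc 1 b)) ∧
    TendstoUniformlyOn
      (fun (M : ℕ) (t : ℝ) => ∑ m ∈ Finset.Icc 1 M, crossTerm b 0 s t m)
      (fun t : ℝ =>
        if t ≤ s then Real.log t * Real.log (b / s) / Real.log b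
        else Real.log s * Real.log (b / t) / Real.log b)
      Filter.atTop (Set.Icc 1 b) :=
  ⟨fun ν => crossZero_enumerates ν hb,
    fun _ hν => tendstoUniformlyOn_two_mul_sum_crossTerm hb hs hν,
    tendstoUniformlyOn_sum_crossTerm_zero hb hs⟩

theorem mainTheorem8 (b s : ℝ) (hs : 1 < s) (hsb : s < b) :
    (∀ ν : ℝ, 0 ≤ ν →
      StrictMono (crossZero b ν) ∧
      crossZero b ν '' Set.Ici 1 = {ρ : ℝ | 0 < ρ ∧ crossU b ν ρ 1 = 0}) ∧
    (∀ ν : ℝ, 0 < ν →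
      TendstoUniformlyOn
        (fun (M : ℕ) (t : ℝ) => 2 * ν * ∑ m ∈ Finset.Icc 1 M, crossTerm b ν s t m)
        (fun t : ℝ =>
          if t ≤ s then psiFun ν t * psiFun ν (b / s) / psiFun ν b
          else psiFun ν s * psiFun ν (b / t) / psiFun ν b)
        Filter.atTop (Set.Icc 1 b)) ∧
    TendstoUniformlyOn
      (fun (M : ℕ) (t : ℝ) => ∑ m ∈ Finset.Icc 1 M, crossTerm b 0 s t m)
      (fun t : ℝ =>
        if t ≤ s then Real.log t * Real.log (b / s) / Real.log b
        else Real.log s * Real.log (b / t) / Real.log b)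
      Filter.atTop (Set.Icc 1 b) := by
  obtain ⟨hzeros, hexpansion, hexpansion_zero⟩ :=
    mainTheorem8_general b s (hs.trans hsb) ⟨hs.le, hsb.le⟩
  exact ⟨fun ν _ => hzeros ν, fun ν hν => hexpansion ν hν.ne', hexpansion_zero⟩
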